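/- Let $M$ be a smooth manifold (finite-dimensional, Hausdorff, $\sigma$-compact, without boundary) and let $k,l\ge 0$ be integers. For a differential form $\eta$ write $\ker\eta$ for the distribution of tangent vectors $v$ with $\iota_v\eta=0$; the rank of a $2$-form is the codimension of its kernel. A $1$-form $\alpha$ has constant class $2k+1$ if $\alpha\wedge(d\alpha)^k$ vanishes nowhere and $(d\alpha)^{k+1}\equiv 0$. All forms are smooth. A symplectic pair on $M$ consists of two closed $2$-forms $\omega_1,\omega_2$ of constant ranks $2k,2l>0$ with $2k+2l=\dim M$, such that $\omega_1$ restricts to a symplectic form on the leaves of $\ker\omega_2$ and $\omega_2$ restricts to a symplectic form on the leaves of $\ker\omega_1$. Its characteristic foliations are $\ker\omega_1$ and $\ker\omega_2$. A contact-symplectic pair on $M$ consists of a $1$-form $\alpha$ of constant class $2k+1$ and a closed $2$-form $\beta$ of constant rank $2l$ such that the foliations $\ker(\alpha\wedge(d\alpha)^k)$ and $\ker\beta$ are complementary, $\alpha$ restricts to a contact form on the leaves of $\ker\beta$, and $\beta$ restricts to a symplectic form on the leaves of $\ker(\alpha\wedge(d\alpha)^k)$. Its characteristic foliations are $\ker(\alpha\wedge(d\alpha)^k)$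 and $\ker\beta$. A contact pair on $M$ consists of $1$-forms $\alpha,\gamma$ of constant classes $2k+1$ and $2l+1$ such that the foliations $\ker(\alpha\wedge(d\alpha)^k)$ and $\ker(\gamma\wedge(d\gamma)^l)$ are complementary and each of $\alpha,\gamma$ restricts to a contact form on the leaves of the kernel foliation belonging to the other. Its characteristic foliations are these two kernel foliations. Statement: for every symplectic pair, contact-symplectic pair or contact pair on $M$, the two characteristic distributions are complementary foliations (smooth, of constant rank, closed under Lie brackets), and there is a smooth Riemannian metric $g$ on $M$ for which they are orthogonal and all of their leaves are minimal submanifolds, i.e. the mean curvature vector (with respect to the Levi-Civita connection of $g$) of every leaf of either foliation vanishes identically. -/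

import Mathlib

open scoped Manifold ContDiff Topology
open Bundle

noncomputable section

namespace CharPair

/-! ### Exterior algebra on a vector space -/

section Algebra

variable {V : Type*} [AddCommGroup V] [Module ℝ V]

/-- The wedge product of alternating forms (sum over shuffles). -/
def wedge {m n : ℕ} (a : V [⋀^Fin m]→ₗ[ℝ] ℝ) (b : V [⋀^Fin n]→ₗ[ℝ] ℝ) :
    V [⋀^Fin (m + n)]→ₗ[ℝ] ℝ :=
  ((LinearMap.mul' ℝ ℝ).compAlternatingMap (a.domCoprod b)).domDomCongr finSumFinEquiv

/-- The `k`-th exterior power `η ∧ ⋯ ∧ η` of a `2`-form. -/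
def wedgePow (η : V [⋀^Fin 2]→ₗ[ℝ] ℝ) : (k : ℕ) → V [⋀^Fin (2 * k)]→ₗ[ℝ] ℝ
  | 0 => AlternatingMap.constOfIsEmpty ℝ V (Fin 0) 1
  | k + 1 => wedge (wedgePow η k) η

/-- The kernel of an alternating form: the vectors `v` whose insertion into `η` gives zero. -/
def formKer {n : ℕ} (η : V [⋀^Fin n]→ₗ[ℝ] ℝ) : Submodule ℝ V :=
  ⨅ (w : Fin n → V) (i : Fin n), LinearMap.ker (η.toMultilinearMap.toLinearMap w i)

theorem mem_formKer {n : ℕ} {η : V [⋀^Fin n]→ₗ[ℝ] ℝ} {v : V} :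
    v ∈ formKer η ↔ ∀ (w : Fin n → V) (i : Fin n), η (Function.update w i v) = 0 := by
  simp [formKer]

/-- The rank of an alternating form: the codimension of its kernel. -/
def formRank {n : ℕ} (η : V [⋀^Fin n]→ₗ[ℝ] ℝ) : ℕ :=
  Module.finrank ℝ (V ⧸ formKer η)

end Algebra

/-! ### Differential forms on a manifold -/

section Forms

variable {E : Type*} [NormedAddCommGroup E] [NormedSpace ℝ E]
  {M : Type*} [TopologicalSpace M] [ChartedSpace E M]

variable (E M) in
/-- Differential `n`-forms (not necessarily smooth) on a manifold `M` modelled on `E`. -/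
abbrev DForm (n : ℕ) : Type _ :=
  (x : M) → (TangentSpace 𝓘(ℝ, E) x) [⋀^Fin n]→L[ℝ] ℝ

/-- The expression of a differential form in the preferred chart at `x₀`: its pullback under the
inverse of the chart. -/
def formInChart {n : ℕ} (η : DForm E M n) (x₀ : M) (y : E) : E [⋀^Fin n]→L[ℝ] ℝ :=
  (η ((extChartAt 𝓘(ℝ, E) x₀).symm y)).compContinuousLinearMap
    (mfderiv 𝓘(ℝ, E) 𝓘(ℝ, E) (extChartAt 𝓘(ℝ, E) x₀).symm y : E →L[ℝ] _)

/-- A differential form is smooth if it is smooth in charts. -/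
def IsSmoothForm {n : ℕ} (η : DForm E M n) : Prop :=
  ∀ x₀ : M, ContDiffOn ℝ ∞ (formInChart η x₀) (extChartAt 𝓘(ℝ, E) x₀).target

/-- The exterior derivative, computed at `x` in the preferred chart at `x`. -/
def extDer {n : ℕ} (η : DForm E M n) : DForm E M (n + 1) := fun x ↦
  (extDeriv (formInChart η x) (extChartAt 𝓘(ℝ, E) x x)).compContinuousLinearMap
    (mfderiv 𝓘(ℝ, E) 𝓘(ℝ, E) (extChartAt 𝓘(ℝ, E) x) x : _ →L[ℝ] E)

/-- A form is closed if its exterior derivative vanishes. -/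
def IsClosedForm {n : ℕ} (η : DForm E M n) : Prop := ∀ x, extDer η x = 0

/-- The value at `x` as an algebraic alternating form. -/
abbrev formAt {n : ℕ} (η : DForm E M n) (x : M) :
    (TangentSpace 𝓘(ℝ, E) x) [⋀^Fin n]→ₗ[ℝ] ℝ := (η x).toAlternatingMap

/-- The `(2k+1)`-form `α ∧ (dα)^k` of a `1`-form `α`. -/
def contactForm (α : DForm E M 1) (k : ℕ) (x : M) :
    (TangentSpace 𝓘(ℝ, E) x) [⋀^Fin (1 + 2 * k)]→ₗ[ℝ] ℝ :=
  wedge (formAt α x) (wedgePow (formAt (extDer α) x) k)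

variable (E M) in
/-- A field of subspaces of the tangent spaces. -/
abbrev Distribution : Type _ := (x : M) → Submodule ℝ (TangentSpace 𝓘(ℝ, E) x)

/-- The kernel distribution of a `2`-form. -/
def kerTwo (η : DForm E M 2) : Distribution E M := fun x ↦ formKer (formAt η x)

/-- The kernel distribution of `α ∧ (dα)^k`. -/
def kerContact (α : DForm E M 1) (k : ℕ) : Distribution E M := fun x ↦ formKer (contactForm α k x)

/-- The `1`-form `α` has constant class `2k+1`: `α ∧ (dα)^k` vanishes nowhere and
`(dα)^(k+1)` vanishes identically. -/
def HasConstantClass (α : DForm E M 1) (k : ℕ) : Prop :=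
  ∀ x, contactForm α k x ≠ 0 ∧ wedgePow (formAt (extDer α) x) (k + 1) = 0

/-- The `2`-form `η` restricts to a nondegenerate form on each `D x`; for a closed form `η` and
an integrable distribution `D`, this says that `η` is symplectic on the leaves. -/
def IsSymplecticOn (η : DForm E M 2) (D : Distribution E M) : Prop :=
  ∀ x, ∀ v ∈ D x, (∀ w ∈ D x, η x ![v, w] = 0) → v = 0

/-- The `1`-form `α` restricts to a contact form on the leaves tangent to `D`: these have dimension
`2k+1` and `α ∧ (dα)^k` restricts to a volume form on them. -/
def IsContactOn (α : DForm E M 1) (k : ℕ) (D : Distribution E M) : Prop :=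
  ∀ x, Module.finrank ℝ (D x) = 2 * k + 1 ∧
    ∃ v : Fin (1 + 2 * k) → TangentSpace 𝓘(ℝ, E) x,
      (∀ i, v i ∈ D x) ∧ contactForm α k x v ≠ 0

/-- A symplectic pair: closed `2`-forms, not identically zero, of constant complementary ranks
`2k` and `2l`, each symplectic on the leaves of the kernel foliation of the other. -/
structure IsSymplecticPair (k l : ℕ) (η₁ η₂ : DForm E M 2) : Prop where
  smooth₁ : IsSmoothForm η₁
  smooth₂ : IsSmoothForm η₂
  closed₁ : IsClosedForm η₁
  closed₂ : IsClosedForm η₂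
  pos₁ : 0 < k
  pos₂ : 0 < l
  rank₁ : ∀ x, formRank (formAt η₁ x) = 2 * k
  rank₂ : ∀ x, formRank (formAt η₂ x) = 2 * l
  complementary : 2 * k + 2 * l = Module.finrank ℝ E
  symplectic₁ : IsSymplecticOn η₁ (kerTwo η₂)
  symplectic₂ : IsSymplecticOn η₂ (kerTwo η₁)

/-- A contact-symplectic pair: a `1`-form `α` of constant class `2k+1` and a closed `2`-form `β` of
constant rank `2l`, with complementary kernel foliations, such that `α` is contact on the leaves of
`ker β` and `β` is symplectic on the leaves of `ker (α ∧ (dα)^k)`. -/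
structure IsContactSymplecticPair (k l : ℕ) (α : DForm E M 1) (β : DForm E M 2) : Prop where
  smooth₁ : IsSmoothForm α
  smooth₂ : IsSmoothForm β
  class₁ : HasConstantClass α k
  closed₂ : IsClosedForm β
  rank₂ : ∀ x, formRank (formAt β x) = 2 * l
  complementary : ∀ x, IsCompl (kerContact α k x) (kerTwo β x)
  contact₁ : IsContactOn α k (kerTwo β)
  symplectic₂ : IsSymplecticOn β (kerContact α k)

/-- A contact pair: `1`-forms `α`, `γ` of constant classes `2k+1` and `2l+1`, with complementary
kernel foliations, each being contact on the leaves of the kernel foliation of the other. -/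
structure IsContactPair (k l : ℕ) (α γ : DForm E M 1) : Prop where
  smooth₁ : IsSmoothForm α
  smooth₂ : IsSmoothForm γ
  class₁ : HasConstantClass α k
  class₂ : HasConstantClass γ l
  complementary : ∀ x, IsCompl (kerContact α k x) (kerContact γ l x)
  contact₁ : IsContactOn α k (kerContact γ l)
  contact₂ : IsContactOn γ l (kerContact α k)

end Forms

/-! ### Foliations and minimality of their leaves -/

section Metric

universe u v

variable {E : Type u} [NormedAddCommGroup E] [NormedSpace ℝ E]
  {M : Type v} [TopologicalSpace M] [ChartedSpace E M]

variable (E M) in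
/-- Vector fields (not necessarily smooth). -/
abbrev VField : Type _ := (x : M) → TangentSpace 𝓘(ℝ, E) x

variable [IsManifold 𝓘(ℝ, E) ∞ M]

/-- The vector field `X` is smooth at `x`. -/
abbrev SmoothFieldAt (X : VField E M) (x : M) : Prop :=
  ContMDiffAt 𝓘(ℝ, E) 𝓘(ℝ, E).tangent ∞ (fun z ↦ (X z : TangentBundle 𝓘(ℝ, E) M)) x

/-- A foliation, given by its tangent distribution: a smooth distribution of constant rank
that is closed under Lie brackets. -/
structure IsFoliation (D : Distribution E M) : Prop where
  constant_rank : ∃ p : ℕ, ∀ x, Module.finrank ℝ (D x) = p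
  smooth : ∀ x, ∀ v ∈ D x, ∃ X : VField E M,
    (∀ z, SmoothFieldAt X z) ∧ (∀ z, X z ∈ D z) ∧ X x = v
  involutive : ∀ (X Y : VField E M) (x : M), SmoothFieldAt X x → SmoothFieldAt Y x →
    (∀ᶠ z in 𝓝 x, X z ∈ D z) → (∀ᶠ z in 𝓝 x, Y z ∈ D z) →
    VectorField.mlieBracket 𝓘(ℝ, E) X Y x ∈ D x

variable (E M) in
/-- Smooth Riemannian metrics on `M`. -/
abbrev Metric : Type _ :=
  ContMDiffRiemannianMetric 𝓘(ℝ, E) ∞ E (fun x : M ↦ TangentSpace 𝓘(ℝ, E) x)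

/-- The function `g(∇_X Y, Z)`, where `∇` is the Levi-Civita connection of `g`, given by the
Koszul formula. -/
def Metric.leviCivita (g : Metric E M) (X Y Z : VField E M) (x : M) : ℝ :=
  (mvfderiv 𝓘(ℝ, E) (fun z ↦ g.inner z (Y z) (Z z)) x (X x)
    + mvfderiv 𝓘(ℝ, E) (fun z ↦ g.inner z (X z) (Z z)) x (Y x)
    - mvfderiv 𝓘(ℝ, E) (fun z ↦ g.inner z (X z) (Y z)) x (Z x)
    + g.inner x (VectorField.mlieBracket 𝓘(ℝ, E) X Y x) (Z x)
    - g.inner x (VectorField.mlieBracket 𝓘(ℝ, E) X Z x) (Y x)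
    - g.inner x (VectorField.mlieBracket 𝓘(ℝ, E) Y Z x) (X x)) / 2

/-- The Koszul formula: `Metric.leviCivita` is `g(∇_X Y, Z)` for every torsion-free metric
connection `∇` (note `∇_X Y = cov Y x (X x)` in Mathlib's argument order). -/
theorem Metric.leviCivita_eq [FiniteDimensional ℝ E] (g : Metric E M)
    (cov : CovariantDerivative 𝓘(ℝ, E) E (fun x : M ↦ TangentSpace 𝓘(ℝ, E) x))
    (metric : ∀ (A B C : VField E M) (x : M), SmoothFieldAt A x → SmoothFieldAt B x →
      SmoothFieldAt C x → mvfderiv 𝓘(ℝ, E) (fun z ↦ g.inner z (B z) (C z)) x (A x) =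
        g.inner x (cov B x (A x)) (C x) + g.inner x (B x) (cov C x (A x)))
    (torsion_free : ∀ (A B : VField E M) (x : M), SmoothFieldAt A x → SmoothFieldAt B x →
      cov B x (A x) - cov A x (B x) = VectorField.mlieBracket 𝓘(ℝ, E) A B x)
    (X Y Z : VField E M) (x : M) (hX : SmoothFieldAt X x) (hY : SmoothFieldAt Y x)
    (hZ : SmoothFieldAt Z x) :
    g.leviCivita X Y Z x = g.inner x (cov Y x (X x)) (Z x) := by
  unfold Metric.leviCivita
  rw [metric X Y Z x hX hY hZ, metric Y X Z x hY hX hZ, metric Z X Y x hZ hX hY,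
    ← torsion_free X Y x hX hY, ← torsion_free X Z x hX hZ, ← torsion_free Y Z x hY hZ]
  simp only [map_sub, sub_apply]
  rw [g.symm x (X x) (cov Z x (Y x)), g.symm x (X x) (cov Y x (Z x)), g.symm x (Y x)]
  ring

/-- Consider a `p`-dimensional submanifold through `x` and let `IsTangent X` say that the vector
field `X` on `M` is tangent to it along it, near `x`. Its mean curvature vector at `x` is the sum
`H = ∑ i, (∇_{e i} (e i))^⊥` for `e 0, …, e (p-1)` tangent fields that are orthonormal at `x`.
This predicate says `H = 0`, i.e. `g(H, N) = 0` for every normal vector `N`. -/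
def MeanCurvatureZeroAt (g : Metric E M) (x : M) (p : ℕ) (IsTangent : VField E M → Prop) : Prop :=
  ∀ (e : Fin p → VField E M) (N : VField E M),
    (∀ i, SmoothFieldAt (e i) x) → (∀ i, IsTangent (e i)) →
    (∀ i j, g.inner x (e i x) (e j x) = if i = j then 1 else 0) →
    SmoothFieldAt N x → (∀ i, g.inner x (e i x) (N x) = 0) →
    ∑ i, g.leviCivita (e i) (e i) N x = 0

/-- `f : L → M` is a (possibly not injectively) immersed integral manifold of `D`: a smooth map
whose differential maps each tangent space of `L` isomorphically onto `D`. The leaves of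
a foliation are its maximal connected injectively immersed integral manifolds. -/
structure IsIntegralManifold (D : Distribution E M) {p : ℕ} {L : Type v} [TopologicalSpace L]
    [ChartedSpace (EuclideanSpace ℝ (Fin p)) L] (f : L → M) : Prop where
  smooth : ContMDiff (𝓡 p) 𝓘(ℝ, E) ∞ f
  injective : ∀ y, Function.Injective (mfderiv (𝓡 p) 𝓘(ℝ, E) f y)
  range_eq : ∀ y, (mfderiv (𝓡 p) 𝓘(ℝ, E) f y).range = D (f y)

/-- The leaves of the foliation with tangent distribution `D` are minimal: their mean curvature
vectors vanish at every point of `M`. This is expressed both through vector fields tangent to the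
foliation, and through integral manifolds (in particular leaves) as immersed submanifolds. -/
structure HasMinimalLeaves (g : Metric E M) (D : Distribution E M) : Prop where
  meanCurvature_eq_zero : ∀ x : M,
    MeanCurvatureZeroAt g x (Module.finrank ℝ (D x)) (fun X ↦ ∀ᶠ z in 𝓝 x, X z ∈ D z)
  minimal_leaf : ∀ (p : ℕ) (L : Type v) [TopologicalSpace L]
    [ChartedSpace (EuclideanSpace ℝ (Fin p)) L] [IsManifold (𝓡 p) ∞ L] (f : L → M),
    IsIntegralManifold D (p := p) f → ∀ y : L,
      MeanCurvatureZeroAt g (f y) p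
        (fun X ↦ ∀ᶠ z in 𝓝 y, X (f z) ∈ (mfderiv (𝓡 p) 𝓘(ℝ, E) f z).range)

/-- `D₁` and `D₂` are complementary foliations, and some Riemannian metric makes them
orthogonal with minimal leaves. -/
def AdmitOrthogonalMinimalMetric (D₁ D₂ : Distribution E M) : Prop :=
  IsFoliation D₁ ∧ IsFoliation D₂ ∧ (∀ x, IsCompl (D₁ x) (D₂ x)) ∧
  ∃ g : Metric E M, (∀ x, ∀ v ∈ D₁ x, ∀ w ∈ D₂ x, g.inner x v w = 0) ∧
    HasMinimalLeaves g D₁ ∧ HasMinimalLeaves g D₂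

end Metric

end CharPair

end

set_option linter.unusedSectionVars false

/-! Each characteristic distribution D is the kernel of a smooth field B of bilinear forms that is
invariant along D: B = η for a closed 2-form η, and B = dα + α ⊗ α for a contact form α. Invariance
means L_N B = 0 for N tangent to D. Because B(N, ·) and B(·, N) vanish, this reduces in a chart to
the pointwise identity D_N B(u, v) = D_u B(N, v) + D_v B(u, N). It follows from dη = 0 in the first
case, and from α(N) = 0 and ι_N dα = 0 in the second. `IsTransverseForm` records these properties,
and the geometry is done once for two complementary distributions D₁, D₂ with such forms B₁, B₂.

Invariance makes the kernels involutive. The sum B₁ + B₂ is nondegenerate, and (B₁ + B₂)⁻¹ B₁ is the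
projection onto D₂ along D₁; hence the projections are smooth, and so are the distributions.

Minimality is Rummler's criterion. The form B₂ is nondegenerate on D₁ and invariant along D₂, so the
density |det B₂|^(1/2) on D₁ is invariant too. If D₁ ⊥ D₂ and this density is the Riemannian volume
of the leaves of D₁, their volume has zero first variation in every normal direction. The
infinitesimal version is `sum_secondFundamentalForm_eq_zero`. A suitable metric
(`exists_adapted_metric`) comes from an arbitrary one by dropping the mixed terms and rescaling on
D₁ and on D₂; comparing squared Gram determinants makes signs irrelevant.

For contact forms one also needs ker(α ∧ (dα)^k) = ker α ∩ ker dα (`formKer_contact_eq`). One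
inclusion is formal. The other is a count of codimensions: (dα)^(k+1) = 0 forces dα to have rank at
most 2k, since otherwise evaluation on k + 1 symplectic pairs of vectors would be nonzero. -/

noncomputable section

namespace CharPair

/-! ### Calculus in a vector space: involutivity and the trace of the second fundamental form -/

section LocalCalculus

open Matrix

variable {E : Type*} [NormedAddCommGroup E] [NormedSpace ℝ E]

/-- Jacobi's formula for the derivative of a determinant. -/
theorem hasFDerivAt_det {n : Type*} [Fintype n] [DecidableEq n] {A : E → Matrix n n ℝ} {y : E}
    {A' : n → n → E →L[ℝ] ℝ} (hA : ∀ i j, HasFDerivAt (fun z ↦ A z i j) (A' i j) y) :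
    HasFDerivAt (fun z ↦ (A z).det) (∑ i, ∑ j, (A y).adjugate j i • A' i j) y := by
  let d : ContinuousMultilinearMap ℝ (fun _ : n ↦ n → ℝ) ℝ :=
    ⟨(detRowAlternating : (n → ℝ) [⋀^n]→ₗ[ℝ] ℝ).toMultilinearMap,
      (continuous_id (X := Matrix n n ℝ)).matrix_det⟩
  have hA' : HasFDerivAt (fun z ↦ (A z : n → n → ℝ))
      (ContinuousLinearMap.pi fun i ↦ ContinuousLinearMap.pi fun j ↦ A' i j) y :=
    hasFDerivAt_pi.2 fun i ↦ hasFDerivAt_pi.2 fun j ↦ hA i j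
  have h := (d.hasFDerivAt (A y)).comp y hA'
  refine h.congr_fderiv ?_
  ext v
  refine (d.linearDeriv_apply _ _).trans ?_
  rw [_root_.sum_apply]
  refine Finset.sum_congr rfl fun i _ ↦ ?_
  -- The derivative of a multilinear map replaces one row at a time; Cramer's rule expands along the
  -- replaced row.
  change ((A y).updateRow i fun j ↦ A' i j v).det = _
  rw [_root_.sum_apply, ← cramer_transpose_apply, cramer_eq_adjugate_mulVec, mulVec, dotProduct]
  refine Finset.sum_congr rfl fun j _ ↦ ?_
  rw [← adjugate_transpose]
  rfl

theorem fderiv_bilin_apply {b : E → E →L[ℝ] E →L[ℝ] ℝ} {X Y : E → E} {y : E}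
    (hb : DifferentiableAt ℝ b y) (hX : DifferentiableAt ℝ X y) (hY : DifferentiableAt ℝ Y y)
    (v : E) :
    fderiv ℝ (fun z ↦ b z (X z) (Y z)) y v = fderiv ℝ b y v (X y) (Y y) +
      b y (fderiv ℝ X y v) (Y y) + b y (X y) (fderiv ℝ Y y v) := by
  rw [((hb.hasFDerivAt.clm_apply hX.hasFDerivAt).clm_apply hY.hasFDerivAt).fderiv]
  simp
  ring

theorem bilin_fderiv_of_eventually_eq_zero {b : E → E →L[ℝ] E →L[ℝ] ℝ} {X Y : E → E} {y : E}
    (hb : DifferentiableAt ℝ b y) (hX : DifferentiableAt ℝ X y) (hY : DifferentiableAt ℝ Y y)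
    (h : ∀ᶠ z in 𝓝 y, b z (X z) (Y z) = 0) (v : E) :
    fderiv ℝ b y v (X y) (Y y) + b y (fderiv ℝ X y v) (Y y) + b y (X y) (fderiv ℝ Y y v) = 0 := by
  rw [← fderiv_bilin_apply hb hX hY, Filter.EventuallyEq.fderiv_eq (f := fun _ ↦ (0 : ℝ)) h]
  simp

/-- The kernel of a bilinear form field that is infinitesimally invariant along its kernel
is closed under Lie brackets. -/
theorem bilin_lieBracket_eq_zero {b : E → E →L[ℝ] E →L[ℝ] ℝ} {X Y : E → E} {y : E}
    (hb : DifferentiableAt ℝ b y) (hX : DifferentiableAt ℝ X y) (hY : DifferentiableAt ℝ Y y)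
    (hXl : ∀ᶠ z in 𝓝 y, ∀ w, b z (X z) w = 0) (hYl : ∀ᶠ z in 𝓝 y, ∀ w, b z (Y z) w = 0)
    (hXr : ∀ w, b y w (X y) = 0)
    (inv : ∀ u v, fderiv ℝ b y (X y) u v = fderiv ℝ b y u (X y) v + fderiv ℝ b y v u (X y))
    (w : E) : b y (VectorField.lieBracket ℝ X Y y) w = 0 := by
  -- The identities b(X, w) = 0, b(Y, w) = 0 and b(Y, X) = 0 are differentiated along Y, X and w.
  -- The third loses its terms in DX and DY, and `inv` links the remaining derivatives of `b`.
  have h1 := bilin_fderiv_of_eventually_eq_zero hb hX (differentiableAt_const w)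
    (hXl.mono fun z hz ↦ hz w) (Y y)
  have h2 := bilin_fderiv_of_eventually_eq_zero hb hY (differentiableAt_const w)
    (hYl.mono fun z hz ↦ hz w) (X y)
  have h3 := bilin_fderiv_of_eventually_eq_zero hb hY hX (hYl.mono fun z hz ↦ hz (X z)) w
  have h4 := inv (Y y) w
  rw [hXr, hYl.self_of_nhds] at h3
  simp only [fderiv_const_apply, _root_.zero_apply, map_zero] at h1 h2
  rw [VectorField.lieBracket, map_sub, _root_.sub_apply]
  linarith

/-- The infinitesimal form of Rummler's criterion: if `b` is invariant along its kernel, the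
range of the projection `P`, and the squared Gram determinants of `b` and of the metric `g` agree
on the kernel of `P`, then the trace of the second fundamental form of the kernel of `P`
vanishes. -/
theorem sum_secondFundamentalForm_eq_zero {b g : E → E →L[ℝ] E →L[ℝ] ℝ} {P : E → E →L[ℝ] E}
    {y : E} {p : ℕ} {e : Fin p → E} {N : E}
    (hb : DifferentiableAt ℝ b y) (hg : DifferentiableAt ℝ g y) (hP : DifferentiableAt ℝ P y)
    (hbl : ∀ᶠ z in 𝓝 y, ∀ u w, b z (P z u) w = 0) (hbr : ∀ᶠ z in 𝓝 y, ∀ u w, b z w (P z u) = 0)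
    (hPP : ∀ᶠ z in 𝓝 y, ∀ u, P z (P z u) = P z u)
    (hgP : ∀ᶠ z in 𝓝 y, ∀ u w, g z (u - P z u) (P z w) = 0) (hsymm : ∀ u w, g y u w = g y w u)
    (hN : P y N = N) (he : ∀ i, P y (e i) = 0)
    (hee : ∀ i j, g y (e i) (e j) = if i = j then 1 else 0)
    (hspan : ∀ u, P y u = 0 → u = ∑ i, g y u (e i) • e i)
    (hdet : ∀ᶠ z in 𝓝 y, (Matrix.of fun i j ↦ b z (e i) (e j)).det ^ 2 =
      (Matrix.of fun i j ↦ g z (e i - P z (e i)) (e j - P z (e j))).det ^ 2)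
    (inv : ∀ u v, fderiv ℝ b y N u v = fderiv ℝ b y u N v + fderiv ℝ b y v u N) :
    ∑ i, (g y (e i) (fderiv ℝ P y (e i) N) + fderiv ℝ g y N (e i) (e i) / 2) = 0 := by
  have hPu (u : E) : DifferentiableAt ℝ (fun z ↦ P z u) y := hP.clm_apply (differentiableAt_const u)
  have dP (u v : E) : fderiv ℝ (fun z ↦ P z u) y v = fderiv ℝ P y v u := by
    rw [fderiv_clm_apply hP (differentiableAt_const u)]; simp
  set W : E → Matrix (Fin p) (Fin p) ℝ := fun z ↦ Matrix.of fun i j ↦ b z (e i) (e j) with hW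
  set G : E → Matrix (Fin p) (Fin p) ℝ :=
    fun z ↦ Matrix.of fun i j ↦ g z (e i - P z (e i)) (e j - P z (e j)) with hG
  -- The field z ↦ P z N extends N inside the kernel of `b`; β holds the components along the `e j`
  -- of its derivative in the directions `e i`.
  set β : Matrix (Fin p) (Fin p) ℝ := Matrix.of fun i j ↦ g y (fderiv ℝ P y (e i) N) (e j) with hβ
  -- the derivative of the Gram matrix of `b`
  have hbN (u v : E) (hu : P y u = 0) :
      fderiv ℝ b y v N u = - b y (fderiv ℝ P y v N - P y (fderiv ℝ P y v N)) u := by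
    have := bilin_fderiv_of_eventually_eq_zero hb (hPu N) (differentiableAt_const u)
      (hbl.mono fun z hz ↦ hz N u) v
    rw [dP, hN] at this
    simp only [fderiv_const_apply, _root_.zero_apply, map_zero] at this
    rw [map_sub, _root_.sub_apply, hbl.self_of_nhds]
    linarith
  have hbN' (u v : E) (hu : P y u = 0) :
      fderiv ℝ b y v u N = - b y u (fderiv ℝ P y v N - P y (fderiv ℝ P y v N)) := by
    have := bilin_fderiv_of_eventually_eq_zero hb (differentiableAt_const u) (hPu N)
      (hbr.mono fun z hz ↦ hz N u) v
    rw [dP, hN] at this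
    simp only [fderiv_const_apply, _root_.zero_apply, map_zero] at this
    rw [map_sub, hbr.self_of_nhds]
    linarith
  have hexp (i : Fin p) : fderiv ℝ P y (e i) N - P y (fderiv ℝ P y (e i) N) =
      ∑ k, β i k • e k := by
    rw [hspan (fderiv ℝ P y (e i) N - P y (fderiv ℝ P y (e i) N))]
    · refine Finset.sum_congr rfl fun k _ ↦ ?_
      have := hgP.self_of_nhds (e k) (fderiv ℝ P y (e i) N)
      rw [he, sub_zero, hsymm] at this
      rw [map_sub, _root_.sub_apply, this, sub_zero]
      rfl
    · rw [map_sub, hPP.self_of_nhds, sub_self]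
  -- Invariance trades the derivative of `b` along N for derivatives along `e i` and `e j`, where
  -- one argument of `b` is N and `hbN`, `hbN'` apply.
  have hdW (i j : Fin p) : fderiv ℝ b y N (e i) (e j) = -(β * W y + W y * βᵀ) i j := by
    rw [inv, hbN _ _ (he j), hbN' _ _ (he i), hexp, hexp, Matrix.add_apply, Matrix.mul_apply,
      Matrix.mul_apply]
    simp only [map_sum, map_smul, _root_.sum_apply, _root_.smul_apply,
      smul_eq_mul, hW, Matrix.of_apply, Matrix.transpose_apply]
    rw [neg_add, Finset.sum_congr rfl fun k _ ↦ mul_comm (b y (e i) (e k)) (β j k)]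
  -- the derivative of the Gram matrix of `g`
  have hG1 : G y = 1 := by
    ext i j
    simp [hG, he, hee, Matrix.one_apply]
  -- Differentiating P² = P at a vector of ker P shows that the derivative takes values in the range
  -- of P. Hence projecting the constant vectors `e i` does not change the Gram matrix of g to first
  -- order.
  have hdPe (u v : E) (hu : P y u = 0) : P y (fderiv ℝ P y v u) = fderiv ℝ P y v u := by
    have h1 : (fun z ↦ P z (P z u)) =ᶠ[𝓝 y] fun z ↦ P z u := hPP.mono fun z hz ↦ hz u
    have h2 := congrArg (fun L : E →L[ℝ] E ↦ L v) (h1.fderiv_eq (𝕜 := ℝ))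
    simp only [dP] at h2
    rw [fderiv_clm_apply hP (hPu u)] at h2
    simpa [hu, dP] using h2
  have hgde (i : Fin p) (u v : E) (hu : P y u = 0) : g y (e i) (fderiv ℝ P y v u) = 0 := by
    have := hgP.self_of_nhds (e i) (fderiv ℝ P y v u)
    rwa [he, sub_zero, hdPe u v hu] at this
  have hQ (u : E) : DifferentiableAt ℝ (fun z ↦ u - P z u) y :=
    (differentiableAt_const u).sub (hPu u)
  have dQ (u v : E) : fderiv ℝ (fun z ↦ u - P z u) y v = - fderiv ℝ P y v u := by
    rw [fderiv_const_sub]; simp [dP]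
  have hneg (u w : E) : g y u (-w) = -g y u w := by simp
  have hdG (i j : Fin p) : fderiv ℝ (fun z ↦ G z i j) y N = fderiv ℝ g y N (e i) (e j) := by
    have := fderiv_bilin_apply hg (hQ (e i)) (hQ (e j)) N
    simp only [hG, Matrix.of_apply]
    rw [this, dQ, dQ, he, he, sub_zero, sub_zero, hsymm (-_), hneg, hneg, hgde i _ _ (he j),
      hgde j _ _ (he i)]
    ring
  have hWd (i j : Fin p) : DifferentiableAt ℝ (fun z ↦ W z i j) y :=
    (hb.clm_apply (differentiableAt_const _)).clm_apply (differentiableAt_const _)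
  have hdW' (i j : Fin p) : fderiv ℝ (fun z ↦ W z i j) y N = -(β * W y + W y * βᵀ) i j := by
    rw [← hdW]
    have := fderiv_bilin_apply hb (differentiableAt_const (e i)) (differentiableAt_const (e j)) N
    simpa [hW] using this
  have hGd (i j : Fin p) : DifferentiableAt ℝ (fun z ↦ G z i j) y :=
    (hg.clm_apply (hQ _)).clm_apply (hQ _)
  have hDW := (hasFDerivAt_det (A := W) fun i j ↦ (hWd i j).hasFDerivAt).pow 2
  have hDG := (hasFDerivAt_det (A := G) fun i j ↦ (hGd i j).hasFDerivAt).pow 2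
  have key := congrArg (fun L ↦ L N) ((hDW.congr_of_eventuallyEq
    (hdet.mono fun z hz ↦ hz.symm)).unique hDG)
  -- The trace is cyclic and adj(W) W = W adj(W) = det W, so the two summands contribute equally.
  have tr1 : ∑ i, ∑ j, (W y).adjugate j i * (β * W y + W y * βᵀ) i j =
      2 * ((W y).det * β.trace) := by
    have h1 : ∑ i, ∑ j, (W y).adjugate j i * (β * W y + W y * βᵀ) i j =
        ((W y).adjugate * (β * W y + W y * βᵀ)).trace := by
      rw [Finset.sum_comm]
      simp [Matrix.trace, Matrix.mul_apply]
    rw [h1, mul_add, Matrix.trace_add, ← mul_assoc, ← mul_assoc, Matrix.adjugate_mul,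
      Matrix.trace_mul_comm, ← mul_assoc, Matrix.mul_adjugate]
    simp
    ring
  have hdet1 : (W y).det ^ 2 = 1 := by
    have := hdet.self_of_nhds
    rw [this]
    change (G y).det ^ 2 = 1
    simp [hG1]
  simp only [_root_.smul_apply, _root_.sum_apply, smul_eq_mul, hdG,
    hdW', hG1, mul_neg, Finset.sum_neg_distrib, tr1] at key
  have tr2 : ∑ i, ∑ j, (1 : Matrix (Fin p) (Fin p) ℝ).adjugate j i * fderiv ℝ g y N (e i) (e j) =
      ∑ i, fderiv ℝ g y N (e i) (e i) := by
    simp [Matrix.one_apply]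
  rw [tr2] at key
  have hβtr : β.trace = ∑ i, g y (e i) (fderiv ℝ P y (e i) N) := by
    simp [Matrix.trace, hβ, hsymm]
  rw [Finset.sum_add_distrib, ← Finset.sum_div, ← hβtr]
  -- Now `key` says -4 (det W)² tr β = 2 ∑ D_N g(e i, e i), up to the order of the sides, and (det
  -- W)² = 1 because the `e i` are orthonormal at y.
  simp only [Matrix.det_one, pow_one, mul_one, nsmul_eq_mul, Nat.cast_ofNat,
    Nat.add_one_sub_one] at key
  linear_combination (-1 / 4) * key - β.trace * hdet1

end LocalCalculus

/-! ### Tensor fields in the preferred charts -/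

section Charts

variable {E : Type*} [NormedAddCommGroup E] [NormedSpace ℝ E]
  {M : Type*} [TopologicalSpace M] [ChartedSpace E M]

variable (E M) in
/-- Fields of bilinear forms (not necessarily smooth) on the tangent spaces. -/
abbrev BField : Type _ :=
  (x : M) → TangentSpace 𝓘(ℝ, E) x →L[ℝ] TangentSpace 𝓘(ℝ, E) x →L[ℝ] ℝ

variable (E) in
/-- The derivative of the inverse of the preferred chart at `x₀`. -/
def chartFrame (x₀ : M) (y : E) :
    E →L[ℝ] TangentSpace 𝓘(ℝ, E) ((extChartAt 𝓘(ℝ, E) x₀).symm y) :=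
  mfderiv 𝓘(ℝ, E) 𝓘(ℝ, E) (extChartAt 𝓘(ℝ, E) x₀).symm y

/-- The expression of a vector field in the preferred chart at `x₀`. -/
def vecInChart (X : VField E M) (x₀ : M) (y : E) : E :=
  (chartFrame E x₀ y).inverse (X ((extChartAt 𝓘(ℝ, E) x₀).symm y))

/-- The expression of a field of bilinear forms in the preferred chart at `x₀`. -/
def bilInChart (B : BField E M) (x₀ : M) (y : E) : E →L[ℝ] E →L[ℝ] ℝ :=
  (ContinuousLinearMap.precomp ℝ (chartFrame E x₀ y)) ∘L
    (B ((extChartAt 𝓘(ℝ, E) x₀).symm y)) ∘L (chartFrame E x₀ y)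

theorem bilInChart_apply (B : BField E M) (x₀ : M) (y u v : E) :
    bilInChart B x₀ y u v =
      B ((extChartAt 𝓘(ℝ, E) x₀).symm y) (chartFrame E x₀ y u) (chartFrame E x₀ y v) := rfl

theorem chartFrame_eq_mfderivWithin (x₀ : M) (y : E) :
    chartFrame E x₀ y = mfderivWithin 𝓘(ℝ, E) 𝓘(ℝ, E) (extChartAt 𝓘(ℝ, E) x₀).symm
      (Set.range 𝓘(ℝ, E)) y := by
  rw [modelWithCornersSelf_coe, Set.range_id, mfderivWithin_univ]
  rfl

theorem eventually_mem_extChartAt_target (x₀ : M) :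
    ∀ᶠ y in 𝓝 (extChartAt 𝓘(ℝ, E) x₀ x₀), y ∈ (extChartAt 𝓘(ℝ, E) x₀).target := by
  have := extChartAt_target_mem_nhdsWithin (I := 𝓘(ℝ, E)) x₀
  rwa [modelWithCornersSelf_coe, Set.range_id, nhdsWithin_univ] at this

theorem tendsto_extChartAt_symm (x₀ : M) :
    Filter.Tendsto (extChartAt 𝓘(ℝ, E) x₀).symm (𝓝 (extChartAt 𝓘(ℝ, E) x₀ x₀)) (𝓝 x₀) := by
  have := continuousAt_extChartAt_symm (I := 𝓘(ℝ, E)) x₀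
  rw [ContinuousAt, extChartAt_to_inv] at this
  exact this

theorem contDiffAt_congr_iff {F : Type*} [NormedAddCommGroup F] [NormedSpace ℝ F]
    {f g : E → F} {y : E} (h : f =ᶠ[𝓝 y] g) : ContDiffAt ℝ ∞ f y ↔ ContDiffAt ℝ ∞ g y :=
  ⟨fun hf ↦ hf.congr_of_eventuallyEq h.symm, fun hg ↦ hg.congr_of_eventuallyEq h⟩

theorem contMDiffAt_iff_contDiffAt_chart {F : Type*} [NormedAddCommGroup F] [NormedSpace ℝ F]
    {f : M → F} {x₀ : M} :
    ContMDiffAt 𝓘(ℝ, E) 𝓘(ℝ, F) ∞ f x₀ ↔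
      ContDiffAt ℝ ∞ (f ∘ (extChartAt 𝓘(ℝ, E) x₀).symm) (extChartAt 𝓘(ℝ, E) x₀ x₀) := by
  rw [contMDiffAt_iff_source, modelWithCornersSelf_coe, Set.range_id,
    contMDiffWithinAt_univ, contMDiffAt_iff_contDiffAt]

theorem mvfderiv_eq_fderiv {F : Type*} [NormedAddCommGroup F] [NormedSpace ℝ F]
    {f : M → F} {x₀ : M} (hf : ContMDiffAt 𝓘(ℝ, E) 𝓘(ℝ, F) ∞ f x₀) (v : E) :
    mvfderiv 𝓘(ℝ, E) f x₀ v =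
      fderiv ℝ (f ∘ (extChartAt 𝓘(ℝ, E) x₀).symm) (extChartAt 𝓘(ℝ, E) x₀ x₀) v := by
  have := (hf.mdifferentiableAt (by simp)).mfderiv
  rw [mvfderiv, this]
  simp [writtenInExtChartAt, Function.comp_def]
  rfl

variable [IsManifold 𝓘(ℝ, E) ∞ M]

theorem isInvertible_chartFrame {x₀ : M} {y : E} (hy : y ∈ (extChartAt 𝓘(ℝ, E) x₀).target) :
    (chartFrame E x₀ y).IsInvertible := by
  rw [chartFrame_eq_mfderivWithin]
  exact isInvertible_mfderivWithin_extChartAt_symm hy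

/-- The tangent space at x₀ is identified with the model space through the preferred chart at x₀. At
the centre of that chart, fields therefore coincide with their chart expressions, so every pointwise
identity can be checked there. -/
theorem chartFrame_self (x₀ : M) (u : E) :
    (chartFrame E x₀ (extChartAt 𝓘(ℝ, E) x₀ x₀) u : E) = u := by
  have h := mfderivWithin_range_extChartAt_symm (I := 𝓘(ℝ, E)) (x := x₀)
  have h2 := chartFrame_eq_mfderivWithin (E := E) x₀ (extChartAt 𝓘(ℝ, E) x₀ x₀)
  have h3 := h2.trans h
  exact congrArg (fun L : E →L[ℝ] E ↦ L u) h3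

theorem chartFrame_inverse {x₀ : M} {y : E} (hy : y ∈ (extChartAt 𝓘(ℝ, E) x₀).target) :
    (chartFrame E x₀ y).inverse =
      mfderiv 𝓘(ℝ, E) 𝓘(ℝ, E) (extChartAt 𝓘(ℝ, E) x₀) ((extChartAt 𝓘(ℝ, E) x₀).symm y) := by
  refine ContinuousLinearMap.inverse_eq ?_ ?_
  · rw [chartFrame_eq_mfderivWithin]
    exact mfderivWithin_extChartAt_symm_comp_mfderiv_extChartAt hy
  · rw [chartFrame_eq_mfderivWithin]
    exact mfderiv_extChartAt_comp_mfderivWithin_extChartAt_symm hy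

theorem chartFrame_vecInChart (X : VField E M) {x₀ : M} {y : E}
    (hy : y ∈ (extChartAt 𝓘(ℝ, E) x₀).target) :
    chartFrame E x₀ y (vecInChart X x₀ y) = X ((extChartAt 𝓘(ℝ, E) x₀).symm y) :=
  (isInvertible_chartFrame hy).self_apply_inverse _

theorem vecInChart_self (X : VField E M) (x₀ : M) :
    vecInChart X x₀ (extChartAt 𝓘(ℝ, E) x₀ x₀) = X x₀ := by
  have h := chartFrame_vecInChart X (mem_extChartAt_target (I := 𝓘(ℝ, E)) x₀)
  have h2 := (chartFrame_self x₀ (vecInChart X x₀ (extChartAt 𝓘(ℝ, E) x₀ x₀))).symm.trans h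
  refine h2.trans ?_
  rw [extChartAt_to_inv]

theorem bilInChart_self (B : BField E M) (x₀ : M) (u v : E) :
    bilInChart B x₀ (extChartAt 𝓘(ℝ, E) x₀ x₀) u v = B x₀ u v := by
  rw [bilInChart_apply]
  have h : ∀ z : M, z = x₀ → ∀ u' v' : E, u' = u → v' = v → B z u' v' = B x₀ u v := by
    rintro z rfl _ _ rfl rfl
    rfl
  exact h _ (extChartAt_to_inv x₀) _ _ (chartFrame_self x₀ u) (chartFrame_self x₀ v)

theorem bilInChart_vecInChart (B : BField E M) (X Y : VField E M) {x₀ : M} {y : E}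
    (hy : y ∈ (extChartAt 𝓘(ℝ, E) x₀).target) :
    bilInChart B x₀ y (vecInChart X x₀ y) (vecInChart Y x₀ y) =
      B ((extChartAt 𝓘(ℝ, E) x₀).symm y) (X ((extChartAt 𝓘(ℝ, E) x₀).symm y))
        (Y ((extChartAt 𝓘(ℝ, E) x₀).symm y)) := by
  rw [bilInChart_apply, chartFrame_vecInChart X hy, chartFrame_vecInChart Y hy]

theorem smoothFieldAt_iff {X : VField E M} {x₀ : M} :
    SmoothFieldAt X x₀ ↔ ContDiffAt ℝ ∞ (vecInChart X x₀) (extChartAt 𝓘(ℝ, E) x₀ x₀) := by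
  rw [SmoothFieldAt, contMDiffAt_section, contMDiffAt_iff_contDiffAt_chart]
  refine contDiffAt_congr_iff ?_
  filter_upwards [eventually_mem_extChartAt_target x₀] with y hy
  have hz : (extChartAt 𝓘(ℝ, E) x₀).symm y ∈ (chartAt E x₀).source := by
    rw [← extChartAt_source 𝓘(ℝ, E)]
    exact (extChartAt 𝓘(ℝ, E) x₀).map_target hy
  have h := TangentBundle.continuousLinearMapAt_trivializationAt (I := 𝓘(ℝ, E)) hz
  rw [vecInChart, chartFrame_inverse hy, ← h, Function.comp_apply,
    Trivialization.continuousLinearMapAt_apply, Trivialization.coe_linearMapAt_of_mem]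
  simpa using hz

theorem contMDiffAt_bilin_iff {B : BField E M} {x₀ : M} :
    ContMDiffAt 𝓘(ℝ, E) (𝓘(ℝ, E).prod 𝓘(ℝ, E →L[ℝ] E →L[ℝ] ℝ)) ∞
      (fun x ↦ TotalSpace.mk' (E →L[ℝ] E →L[ℝ] ℝ)
        (E := fun x : M ↦ TangentSpace 𝓘(ℝ, E) x →L[ℝ] TangentSpace 𝓘(ℝ, E) x →L[ℝ] ℝ) x (B x))
      x₀ ↔ ContDiffAt ℝ ∞ (bilInChart B x₀) (extChartAt 𝓘(ℝ, E) x₀ x₀) := by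
  rw [contMDiffAt_section, contMDiffAt_iff_contDiffAt_chart]
  refine contDiffAt_congr_iff ?_
  filter_upwards [eventually_mem_extChartAt_target x₀] with y hy
  have hz : (extChartAt 𝓘(ℝ, E) x₀).symm y ∈ (chartAt E x₀).source := by
    rw [← extChartAt_source 𝓘(ℝ, E)]
    exact (extChartAt 𝓘(ℝ, E) x₀).map_target hy
  have h := TangentBundle.symmL_trivializationAt (I := 𝓘(ℝ, E)) hz
  rw [(extChartAt 𝓘(ℝ, E) x₀).right_inv hy, ← chartFrame_eq_mfderivWithin] at h
  ext u v
  rw [bilInChart_apply, ← h, Function.comp_apply, hom_trivializationAt_apply]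
  have hz' : (extChartAt 𝓘(ℝ, E) x₀).symm y ∈
      (trivializationAt E (TangentSpace 𝓘(ℝ, E)) x₀).baseSet := by simpa using hz
  refine (inCoordinates_apply_eq₂ hz' hz' (Set.mem_univ _)).trans ?_
  rw [Trivialization.symmL_apply _ hz', Trivialization.symmL_apply _ hz']
  simp

theorem mlieBracket_eq_lieBracket (X Y : VField E M) (x₀ : M) [CompleteSpace E] :
    (VectorField.mlieBracket 𝓘(ℝ, E) X Y x₀ : E) =
      VectorField.lieBracket ℝ (vecInChart X x₀) (vecInChart Y x₀)
        (extChartAt 𝓘(ℝ, E) x₀ x₀) := by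
  rw [VectorField.mlieBracket, VectorField.mlieBracketWithin_apply, mfderiv_extChartAt_self]
  simp only [modelWithCornersSelf_coe, Set.range_id, VectorField.mpullbackWithin_univ,
    Set.preimage_univ, Set.inter_univ]
  have h (w : E) : (ContinuousLinearMap.id ℝ E).inverse w = w := by
    rw [ContinuousLinearMap.inverse_id, ContinuousLinearMap.id_apply]
  exact (h _).trans (congrFun (VectorField.lieBracketWithin_univ (𝕜 := ℝ) (E := E)
    (V := vecInChart X x₀) (W := vecInChart Y x₀)) _)

end Charts

/-! ### Transverse forms: involutivity and smooth projections -/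

section Transverse

universe u v

variable {E : Type u} [NormedAddCommGroup E] [NormedSpace ℝ E]
  {M : Type v} [TopologicalSpace M] [ChartedSpace E M]

/-- The smooth field `B` of bilinear forms has left and right kernel `D`, and is infinitesimally
invariant along `D`. -/
structure IsTransverseForm (B : BField E M) (D : Distribution E M) : Prop where
  smooth : ∀ x, ContDiffAt ℝ ∞ (bilInChart B x) (extChartAt 𝓘(ℝ, E) x x)
  mem_iff : ∀ x v, v ∈ D x ↔ ∀ w, B x v w = 0
  right : ∀ x, ∀ v ∈ D x, ∀ w, B x w v = 0
  inv : ∀ x, ∀ N : E, N ∈ D x → ∀ u v : E,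
    fderiv ℝ (bilInChart B x) (extChartAt 𝓘(ℝ, E) x x) N u v =
      fderiv ℝ (bilInChart B x) (extChartAt 𝓘(ℝ, E) x x) u N v +
        fderiv ℝ (bilInChart B x) (extChartAt 𝓘(ℝ, E) x x) v u N

theorem differentiableAt_of_smooth {F : Type*} [NormedAddCommGroup F] [NormedSpace ℝ F]
    {f : E → F} {y : E} (h : ContDiffAt ℝ ∞ f y) : DifferentiableAt ℝ f y :=
  h.differentiableAt (by simp)

variable [IsManifold 𝓘(ℝ, E) ∞ M]

theorem IsTransverseForm.involutive [CompleteSpace E] {B : BField E M} {D : Distribution E M}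
    (h : IsTransverseForm B D) (X Y : VField E M) (x : M) (hX : SmoothFieldAt X x)
    (hY : SmoothFieldAt Y x) (hXD : ∀ᶠ z in 𝓝 x, X z ∈ D z) (hYD : ∀ᶠ z in 𝓝 x, Y z ∈ D z) :
    VectorField.mlieBracket 𝓘(ℝ, E) X Y x ∈ D x := by
  rw [h.mem_iff]
  intro w
  have key (Z : VField E M) (hZ : ∀ᶠ z in 𝓝 x, Z z ∈ D z) :
      -- Quantifying over all `w` in the chart is harmless, since the kernel condition holds against
      -- every tangent vector.
      ∀ᶠ y in 𝓝 (extChartAt 𝓘(ℝ, E) x x), ∀ w, bilInChart B x y (vecInChart Z x y) w = 0 := by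
    filter_upwards [eventually_mem_extChartAt_target x, (tendsto_extChartAt_symm x).eventually hZ]
      with y hy hz w
    rw [bilInChart_apply, chartFrame_vecInChart Z hy]
    exact (h.mem_iff _ _).1 hz _
  have hXx : X x ∈ D x := hXD.self_of_nhds
  have := bilin_lieBracket_eq_zero (differentiableAt_of_smooth (h.smooth x))
    (differentiableAt_of_smooth (smoothFieldAt_iff.1 hX))
    (differentiableAt_of_smooth (smoothFieldAt_iff.1 hY)) (key X hXD) (key Y hYD)
    (fun w ↦ by
      rw [bilInChart_self, vecInChart_self]
      exact h.right x _ hXx w)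
    (fun u v ↦ by
      rw [vecInChart_self]
      exact h.inv x _ hXx u v) w
  refine (bilInChart_self B x (VectorField.mlieBracket 𝓘(ℝ, E) X Y x) w).symm.trans ?_
  exact (congrArg (fun a : E ↦ bilInChart B x (extChartAt 𝓘(ℝ, E) x x) a w)
    (mlieBracket_eq_lieBracket X Y x)).trans this

instance [FiniteDimensional ℝ E] (x : M) : FiniteDimensional ℝ (TangentSpace 𝓘(ℝ, E) x) :=
  inferInstanceAs (FiniteDimensional ℝ E)

instance (x : M) : T2Space (TangentSpace 𝓘(ℝ, E) x) := inferInstanceAs (T2Space E)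

/-- The projection onto `D₂ x` along `D₁ x`. -/
def proj [FiniteDimensional ℝ E] {D₁ D₂ : Distribution E M} (h : ∀ x, IsCompl (D₁ x) (D₂ x))
    (x : M) : TangentSpace 𝓘(ℝ, E) x →L[ℝ] TangentSpace 𝓘(ℝ, E) x :=
  LinearMap.toContinuousLinearMap (Submodule.projection (D₂ x) (D₁ x) (h x).symm)

/-- The expression of `proj` in the preferred chart at `x₀`. -/
def projInChart [FiniteDimensional ℝ E] {D₁ D₂ : Distribution E M}
    (h : ∀ x, IsCompl (D₁ x) (D₂ x)) (x₀ : M) (y : E) : E →L[ℝ] E :=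
  (chartFrame E x₀ y).inverse ∘L proj h ((extChartAt 𝓘(ℝ, E) x₀).symm y) ∘L chartFrame E x₀ y

section Proj

variable [FiniteDimensional ℝ E] {D₁ D₂ : Distribution E M}

theorem proj_mem (h : ∀ x, IsCompl (D₁ x) (D₂ x)) (x : M) (v : TangentSpace 𝓘(ℝ, E) x)
    : proj h x v ∈ D₂ x :=
  Submodule.projection_apply_mem (h x).symm v

theorem sub_proj_mem (h : ∀ x, IsCompl (D₁ x) (D₂ x)) (x : M) (v : TangentSpace 𝓘(ℝ, E) x)
    : v - proj h x v ∈ D₁ x := by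
  rw [← Submodule.ker_projection (h x).symm, LinearMap.mem_ker, map_sub]
  have := Submodule.projection_apply_of_mem_left (h x).symm (proj_mem h x v)
  rw [this]
  exact sub_self _

theorem proj_of_mem (h : ∀ x, IsCompl (D₁ x) (D₂ x)) (x : M) {v : TangentSpace 𝓘(ℝ, E) x}
    (hv : v ∈ D₂ x) : proj h x v = v :=
  Submodule.projection_apply_of_mem_left (h x).symm hv

theorem proj_eq_zero (h : ∀ x, IsCompl (D₁ x) (D₂ x)) (x : M) {v : TangentSpace 𝓘(ℝ, E) x}
    (hv : v ∈ D₁ x) : proj h x v = 0 :=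
  Submodule.projection_apply_of_mem_right (h x).symm hv

theorem proj_symm (h : ∀ x, IsCompl (D₁ x) (D₂ x)) (x : M) (v : TangentSpace 𝓘(ℝ, E) x) :
    proj (fun x ↦ (h x).symm) x v = v - proj h x v := by
  have h1 := proj_of_mem (fun x ↦ (h x).symm) x (sub_proj_mem h x v)
  rw [map_sub, proj_eq_zero (fun x ↦ (h x).symm) x (proj_mem h x v), sub_zero] at h1
  exact h1

theorem chartFrame_projInChart (h : ∀ x, IsCompl (D₁ x) (D₂ x)) {x₀ : M} {y : E}
    (hy : y ∈ (extChartAt 𝓘(ℝ, E) x₀).target)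
    (u : E) : chartFrame E x₀ y (projInChart h x₀ y u) =
      proj h ((extChartAt 𝓘(ℝ, E) x₀).symm y) (chartFrame E x₀ y u) :=
  (isInvertible_chartFrame hy).self_apply_inverse _

theorem projInChart_self (h : ∀ x, IsCompl (D₁ x) (D₂ x)) (x₀ : M) (u : E) :
    projInChart h x₀ (extChartAt 𝓘(ℝ, E) x₀ x₀) u = proj h x₀ u := by
  have h1 := chartFrame_projInChart h (mem_extChartAt_target (I := 𝓘(ℝ, E)) x₀) u
  have h2 := (chartFrame_self x₀ _).symm.trans h1
  refine h2.trans ?_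
  have h3 : ∀ z : M, z = x₀ → ∀ u' : E, u' = u → (proj h z u' : E) = proj h x₀ u := by
    rintro z rfl _ rfl
    rfl
  exact h3 _ (extChartAt_to_inv x₀) _ (chartFrame_self x₀ u)

theorem add_apply_proj (h : ∀ x, IsCompl (D₁ x) (D₂ x)) {B₁ B₂ : BField E M}
    (h₁ : IsTransverseForm B₁ D₁)
    (h₂ : IsTransverseForm B₂ D₂) (x : M) (v w : TangentSpace 𝓘(ℝ, E) x) :
    (B₁ x + B₂ x) (proj h x v) w = B₁ x v w := by
  have e1 := (h₁.mem_iff x _).1 (sub_proj_mem h x v) w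
  have e2 := (h₂.mem_iff x _).1 (proj_mem h x v) w
  rw [map_sub, _root_.sub_apply] at e1
  rw [_root_.add_apply, _root_.add_apply, e2]
  linarith

/-- Testing against the D₂-component of w removes B₂ and leaves B₁(v, w), so v lies in D₁; then
B₂(v, ·) = 0 as well, so v lies in D₁ ∩ D₂ = 0. -/
theorem eq_zero_of_add_apply_eq_zero (h : ∀ x, IsCompl (D₁ x) (D₂ x)) {B₁ B₂ : BField E M}
    (h₁ : IsTransverseForm B₁ D₁)
    (h₂ : IsTransverseForm B₂ D₂) (x : M) (v : TangentSpace 𝓘(ℝ, E) x)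
    (hv : ∀ w, (B₁ x + B₂ x) v w = 0) : v = 0 := by
  have m1 : v ∈ D₁ x := by
    rw [h₁.mem_iff]
    intro w
    have e := hv (proj h x w)
    have e1 := h₁.right x _ (sub_proj_mem h x w) v
    have e2 := h₂.right x _ (proj_mem h x w) v
    rw [map_sub] at e1
    rw [_root_.add_apply, _root_.add_apply, e2] at e
    linarith
  have m2 : v ∈ D₂ x := by
    rw [h₂.mem_iff]
    intro w
    have e := hv w
    rw [_root_.add_apply, _root_.add_apply, (h₁.mem_iff x v).1 m1] at e
    linarith
  exact Submodule.disjoint_def.1 (h x).disjoint v m1 m2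

theorem bilInChart_add (B₁ B₂ : BField E M) (x₀ : M) (y : E) :
    bilInChart (fun x ↦ B₁ x + B₂ x) x₀ y = bilInChart B₁ x₀ y + bilInChart B₂ x₀ y := by
  ext u v
  rfl

theorem isInvertible_of_injective {F G : Type*} [NormedAddCommGroup F] [NormedSpace ℝ F]
    [FiniteDimensional ℝ F] [NormedAddCommGroup G] [NormedSpace ℝ G] [FiniteDimensional ℝ G]
    (L : F →L[ℝ] G) (hd : Module.finrank ℝ F = Module.finrank ℝ G)
    (hL : Function.Injective L) : L.IsInvertible :=
  ⟨(LinearEquiv.ofInjectiveOfFinrankEq L.toLinearMap hL hd).toContinuousLinearEquiv, by ext; rfl⟩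

theorem finrank_dual_clm (F : Type*) [NormedAddCommGroup F] [NormedSpace ℝ F]
    [FiniteDimensional ℝ F] : Module.finrank ℝ F = Module.finrank ℝ (F →L[ℝ] ℝ) := by
  rw [← (LinearMap.toContinuousLinearMap (𝕜 := ℝ) (E := F) (F' := ℝ)).finrank_eq]
  exact Subspace.dual_finrank_eq.symm

theorem isInvertible_bilInChart_add (h : ∀ x, IsCompl (D₁ x) (D₂ x)) {B₁ B₂ : BField E M}
    (h₁ : IsTransverseForm B₁ D₁)
    (h₂ : IsTransverseForm B₂ D₂) {x₀ : M} {y : E} (hy : y ∈ (extChartAt 𝓘(ℝ, E) x₀).target) :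
    (bilInChart (fun x ↦ B₁ x + B₂ x) x₀ y).IsInvertible := by
  refine isInvertible_of_injective _ (finrank_dual_clm E) ?_
  rw [injective_iff_map_eq_zero]
  intro u hu
  have hS := isInvertible_chartFrame hy
  have : chartFrame E x₀ y u = 0 := by
    refine eq_zero_of_add_apply_eq_zero h h₁ h₂ _ _ fun w ↦ ?_
    obtain ⟨w, rfl⟩ := hS.bijective.2 w
    exact congrArg (fun L : E →L[ℝ] ℝ ↦ L w) hu
  exact hS.bijective.1 (this.trans (map_zero _).symm)

theorem contDiffAt_inverse_comp {X F G : Type*} [NormedAddCommGroup X] [NormedSpace ℝ X]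
    [NormedAddCommGroup F] [NormedSpace ℝ F] [NormedAddCommGroup G] [NormedSpace ℝ G]
    [CompleteSpace F] {A B : X → F →L[ℝ] G} {y : X} (hA : ContDiffAt ℝ ∞ A y)
    (hB : ContDiffAt ℝ ∞ B y) (hi : (A y).IsInvertible) :
    ContDiffAt ℝ ∞ (fun z ↦ (A z).inverse ∘L B z) y := by
  obtain ⟨L, hL⟩ := hi
  have : ContDiffAt ℝ ∞ (fun z ↦ (A z).inverse) y := by
    have := contDiffAt_map_inverse (𝕜 := ℝ) (n := ∞) L
    rw [hL] at this
    exact this.comp y hA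
  exact this.clm_comp hB

/-- By `add_apply_proj` the projection is (B₁ + B₂)⁻¹ ∘ B₁, and inversion of continuous linear maps
is smooth. No local frames of the distributions are needed. -/
theorem contDiffAt_projInChart (h : ∀ x, IsCompl (D₁ x) (D₂ x)) {B₁ B₂ : BField E M}
    (h₁ : IsTransverseForm B₁ D₁)
    (h₂ : IsTransverseForm B₂ D₂) (x₀ : M) :
    ContDiffAt ℝ ∞ (projInChart h x₀) (extChartAt 𝓘(ℝ, E) x₀ x₀) := by
  have hs : ContDiffAt ℝ ∞ (bilInChart (fun x ↦ B₁ x + B₂ x) x₀) (extChartAt 𝓘(ℝ, E) x₀ x₀) := by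
    simp only [funext (bilInChart_add B₁ B₂ x₀)]
    exact (h₁.smooth x₀).add (h₂.smooth x₀)
  have hc := contDiffAt_inverse_comp (X := E) (F := E) (G := E →L[ℝ] ℝ) hs (h₁.smooth x₀)
    (isInvertible_bilInChart_add h h₁ h₂ (mem_extChartAt_target x₀))
  refine hc.congr_of_eventuallyEq ?_
  filter_upwards [eventually_mem_extChartAt_target x₀] with y hy
  have hinv := isInvertible_bilInChart_add h h₁ h₂ hy
  ext u
  apply hinv.bijective.1
  rw [ContinuousLinearMap.comp_apply, hinv.self_apply_inverse]
  ext w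
  rw [bilInChart_apply, chartFrame_projInChart h hy, add_apply_proj h h₁ h₂]
  rfl

end Proj

end Transverse

/-! ### Gram determinants -/

section Gram

open Matrix

variable {V : Type*} [AddCommGroup V] [Module ℝ V]

/-- The Gram determinant of a family of vectors with respect to a bilinear form. -/
def gramDet {ι : Type*} [Fintype ι] [DecidableEq ι] (B : LinearMap.BilinForm ℝ V) (v : ι → V) : ℝ :=
  (Matrix.of fun i j ↦ B (v i) (v j)).det

variable {ι κ : Type*} [Fintype ι] [DecidableEq ι] [Fintype κ] [DecidableEq κ]

theorem gramDet_sum_smul (B : LinearMap.BilinForm ℝ V) (v : ι → V) (A : Matrix ι ι ℝ) :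
    gramDet B (fun i ↦ ∑ k, A i k • v k) = A.det ^ 2 * gramDet B v := by
  have : (Matrix.of fun i j ↦ B (∑ k, A i k • v k) (∑ k, A j k • v k)) =
      A * (Matrix.of fun i j ↦ B (v i) (v j)) * Aᵀ := by
    ext i j
    simp only [of_apply, map_sum, map_smul, LinearMap.sum_apply, LinearMap.smul_apply,
      mul_apply, transpose_apply, smul_eq_mul, Finset.sum_mul, Finset.mul_sum]
    refine Finset.sum_congr rfl fun k _ ↦ Finset.sum_congr rfl fun l _ ↦ ?_
    ring
  rw [gramDet, this, det_mul, det_mul, det_transpose, gramDet]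
  ring

theorem gramDet_reindex (B : LinearMap.BilinForm ℝ V) (v : ι → V) (σ : κ ≃ ι) :
    gramDet B (v ∘ σ) = gramDet B v := by
  rw [gramDet, gramDet, ← det_submatrix_equiv_self σ (Matrix.of fun i j ↦ B (v i) (v j))]
  rfl

/-- The factor is the squared determinant of the change of basis. It is the same for all forms, so
quotients of Gram determinants do not depend on the basis. -/
theorem exists_gramDet_eq_mul (b : Module.Basis ι ℝ V) (c : Module.Basis κ ℝ V) :
    ∃ r : ℝ, r ≠ 0 ∧ ∀ B : LinearMap.BilinForm ℝ V, gramDet B c = r * gramDet B b := by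
  set σ : ι ≃ κ := b.indexEquiv c
  set c' : Module.Basis ι ℝ V := c.reindex σ.symm
  refine ⟨(b.toMatrix c')ᵀ.det ^ 2, ?_, fun B ↦ ?_⟩
  · refine pow_ne_zero 2 ?_
    rw [det_transpose]
    exact (Matrix.isUnit_det_of_right_inverse (b.toMatrix_mul_toMatrix_flip c')).ne_zero
  · rw [← gramDet_sum_smul, ← gramDet_reindex B c σ]
    congr 1
    ext i
    simp [c']

theorem gramDet_ne_zero (b : Module.Basis ι ℝ V) {B : LinearMap.BilinForm ℝ V}
    (hB : ∀ v, (∀ w, B v w = 0) → v = 0) : gramDet B b ≠ 0 := by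
  intro h
  obtain ⟨a, ha, h0⟩ := exists_vecMul_eq_zero_iff.2 h
  refine ha ?_
  have hv : ∑ i, a i • b i = 0 := by
    refine hB _ fun w ↦ ?_
    have hj (j : ι) : B (∑ i, a i • b i) (b j) = 0 := by
      have := congrFun h0 j
      simpa [vecMul, dotProduct] using this
    have h1 : B (∑ i, a i • b i) = 0 := b.ext fun j ↦ (hj j).trans (LinearMap.zero_apply _).symm
    rw [h1, LinearMap.zero_apply]
  ext i
  exact (Fintype.linearIndependent_iff.1 b.linearIndependent a hv i)

/-- Comparing the volumes of two forms on `D₁`, given by `B₂` and by `g`, by means of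
Gram determinants on the whole space. -/
theorem gramDet_div_mul_gramDet [FiniteDimensional ℝ V] {D₁ D₂ : Submodule ℝ V}
    (hD : IsCompl D₁ D₂) {B₁ B₂ g h : LinearMap.BilinForm ℝ V}
    (hl₁ : ∀ v ∈ D₁, ∀ w, B₁ v w = 0) (hr₁ : ∀ v ∈ D₁, ∀ w, B₁ w v = 0)
    (hl₂ : ∀ v ∈ D₂, ∀ w, B₂ v w = 0) (hr₂ : ∀ v ∈ D₂, ∀ w, B₂ w v = 0)
    (h11 : ∀ v ∈ D₁, ∀ w ∈ D₁, h v w = g v w) (h12 : ∀ v ∈ D₁, ∀ w ∈ D₂, h v w = 0)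
    (h21 : ∀ v ∈ D₂, ∀ w ∈ D₁, h v w = 0)
    (h22 : ∀ v ∈ D₂, ∀ w ∈ D₂, h v w = B₁ v w) (hh : ∀ v, (∀ w, h v w = 0) → v = 0)
    (b : Module.Basis ι ℝ V) (e : κ → V) (he : ∀ i, e i ∈ D₁)
    (hcard : Fintype.card κ = Module.finrank ℝ D₁) :
    gramDet (B₁ + B₂) b / gramDet h b * gramDet g e = gramDet B₂ e := by
  have : Fintype.card κ = Module.finrank ℝ D₁ := hcard
  let u : Module.Basis κ ℝ D₁ := (Module.finBasis ℝ D₁).reindex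
    (Fintype.equivOfCardEq (by simp [hcard]))
  let w := Module.finBasis ℝ D₂
  -- In a basis adapted to D₁ ⊕ D₂ both Gram matrices are block diagonal with the same block B₁ on
  -- D₂, which cancels in the quotient and leaves det B₂ / det g on D₁.
  let c : Module.Basis (κ ⊕ Fin (Module.finrank ℝ D₂)) ℝ V :=
    (u.prod w).map (Submodule.prodEquivOfIsCompl D₁ D₂ hD)
  have cl (i : κ) : c (Sum.inl i) = u i := by simp [c]
  have cr (i : Fin (Module.finrank ℝ D₂)) : c (Sum.inr i) = w i := by simp [c]
  have e1 : gramDet (B₁ + B₂) c = gramDet B₂ (fun i ↦ (u i : V)) *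
      gramDet B₁ (fun i ↦ (w i : V)) := by
    rw [gramDet, gramDet, gramDet, ← det_fromBlocks_zero₂₁ _ 0]
    congr 1
    ext (i | i) (j | j)
    · simp [cl, hl₁ _ (u i).2]
    · simp [cl, cr, hl₁ _ (u i).2, hr₂ _ (w j).2]
    · simp [cl, cr, hr₁ _ (u j).2, hl₂ _ (w i).2]
    · simp [cr, hl₂ _ (w i).2]
  have e2 : gramDet h c = gramDet g (fun i ↦ (u i : V)) * gramDet B₁ (fun i ↦ (w i : V)) := by
    rw [gramDet, gramDet, gramDet, ← det_fromBlocks_zero₂₁ _ 0]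
    congr 1
    ext (i | i) (j | j)
    · simp [cl, h11 _ (u i).2 _ (u j).2]
    · simp [cl, cr, h12 _ (u i).2 _ (w j).2]
    · simp [cl, cr, h21 _ (w i).2 _ (u j).2]
    · simp [cr, h22 _ (w i).2 _ (w j).2]
  obtain ⟨r, hr, hrB⟩ := exists_gramDet_eq_mul c b
  have hne := gramDet_ne_zero c hh
  rw [e2] at hne
  have hg := left_ne_zero_of_mul hne
  have hw := right_ne_zero_of_mul hne
  -- The family `e` may be linearly dependent; it is expressed through the basis `u`, and both sides
  -- acquire the factor (det A)².
  let A : Matrix κ κ ℝ := Matrix.of fun i k ↦ u.repr ⟨e i, he i⟩ k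
  have hA : e = fun i ↦ ∑ k, A i k • (u k : V) := by
    ext i
    have := congrArg Subtype.val (u.sum_repr ⟨e i, he i⟩)
    rw [Submodule.coe_sum] at this
    exact this.symm
  rw [hrB, hrB, e1, e2, hA, gramDet_sum_smul, gramDet_sum_smul]
  field_simp

end Gram

/-! ### Smoothness and boundedness for bilinear forms in finite dimension -/

section Smoothness

variable {E F X : Type*} [NormedAddCommGroup E] [NormedSpace ℝ E] [FiniteDimensional ℝ E]
  [NormedAddCommGroup F] [NormedSpace ℝ F] [NormedAddCommGroup X] [NormedSpace ℝ X]

theorem contDiffAt_clm_of_apply {f : X → E →L[ℝ] F} {y : X}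
    (h : ∀ u, ContDiffAt ℝ ∞ (fun z ↦ f z u) y) : ContDiffAt ℝ ∞ f y := by
  let b := Module.finBasis ℝ E
  have hf : f = fun z ↦ ∑ i, ContinuousLinearMap.smulRightL ℝ E F
      (LinearMap.toContinuousLinearMap (b.coord i)) (f z (b i)) := by
    ext z u
    simp only [_root_.sum_apply, ContinuousLinearMap.smulRightL_apply_apply]
    conv_lhs => rw [← b.sum_repr u]
    rw [map_sum]
    simp
  rw [hf]
  exact ContDiffAt.sum fun i _ ↦ (ContinuousLinearMap.contDiff _).contDiffAt.comp y (h (b i))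

theorem contDiffAt_bilin_of_apply {f : X → E →L[ℝ] E →L[ℝ] ℝ} {y : X}
    (h : ∀ u v, ContDiffAt ℝ ∞ (fun z ↦ f z u v) y) : ContDiffAt ℝ ∞ f y :=
  contDiffAt_clm_of_apply fun u ↦ contDiffAt_clm_of_apply fun v ↦ h u v

theorem contDiffAt_bilin_apply {f : X → E →L[ℝ] E →L[ℝ] ℝ} {y : X} (h : ContDiffAt ℝ ∞ f y)
    {u v : X → E} (hu : ContDiffAt ℝ ∞ u y) (hv : ContDiffAt ℝ ∞ v y) :
    ContDiffAt ℝ ∞ (fun z ↦ f z (u z) (v z)) y :=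
  (h.clm_apply hu).clm_apply hv

theorem contDiffAt_gramDet {ι : Type*} [Fintype ι] [DecidableEq ι] {f : X → E →L[ℝ] E →L[ℝ] ℝ}
    {y : X} (h : ContDiffAt ℝ ∞ f y) (e : ι → E) :
    ContDiffAt ℝ ∞ (fun z ↦ gramDet (f z).toBilinForm e) y := by
  simp only [gramDet, Matrix.det_apply]
  refine ContDiffAt.sum fun σ _ ↦ ContDiffAt.const_smul _ ?_
  exact contDiffAt_prod fun i _ ↦ contDiffAt_bilin_apply h contDiffAt_const contDiffAt_const

/-- On the compact unit sphere B(v, v) has a positive minimum m, so B(v, v) ≥ m‖v‖². This is the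
boundedness field of the Riemannian metric structure. -/
theorem isVonNBounded_of_posDef {B : E →L[ℝ] E →L[ℝ] ℝ} (hB : ∀ v, v ≠ 0 → 0 < B v v) :
    Bornology.IsVonNBounded ℝ {v : E | B v v < 1} := by
  rw [NormedSpace.isVonNBounded_iff]
  have hcont : Continuous fun v ↦ B v v := by fun_prop
  have hscale (v : E) (hv : v ≠ 0) : B v v = ‖v‖ ^ 2 * B (‖v‖⁻¹ • v) (‖v‖⁻¹ • v) := by
    have : ‖v‖ ≠ 0 := norm_ne_zero_iff.2 hv
    simp
    field_simp
  have hmem (v : E) (hv : v ≠ 0) : ‖v‖⁻¹ • v ∈ Metric.sphere (0 : E) 1 := by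
    have : ‖v‖ ≠ 0 := norm_ne_zero_iff.2 hv
    simp [norm_smul, this]
  rcases (Metric.sphere (0 : E) 1).eq_empty_or_nonempty with hs | hs
  · refine (Bornology.isBounded_singleton (x := (0 : E))).subset fun v _ ↦ ?_
    by_contra hv
    have := hmem v hv
    rw [hs] at this
    exact this
  · obtain ⟨u, hu, hmin⟩ := (isCompact_sphere (0 : E) 1).exists_isMinOn hs hcont.continuousOn
    have hu0 : u ≠ 0 := by
      rintro rfl
      simp at hu
    have hm := hB u hu0
    refine (Metric.isBounded_closedBall (x := (0 : E)) (r := Real.sqrt (B u u)⁻¹)).subset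
      fun v hv ↦ ?_
    rw [mem_closedBall_zero_iff]
    rcases eq_or_ne v 0 with rfl | hv0
    · simp
    refine Real.le_sqrt_of_sq_le ?_
    have h1 : B u u ≤ B (‖v‖⁻¹ • v) (‖v‖⁻¹ • v) := hmin (hmem v hv0)
    have h2 : B v v < 1 := hv
    rw [hscale v hv0] at h2
    rw [← one_div, le_div_iff₀ hm]
    nlinarith [sq_nonneg ‖v‖]

end Smoothness

/-! ### Global smooth fields and metrics from partitions of unity -/

section Existence

variable {E : Type*} [NormedAddCommGroup E] [NormedSpace ℝ E] [FiniteDimensional ℝ E]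
  {M : Type*} [TopologicalSpace M] [ChartedSpace E M] [IsManifold 𝓘(ℝ, E) ∞ M]
  [T2Space M] [SigmaCompactSpace M]

theorem exists_smoothField (x : M) (v : TangentSpace 𝓘(ℝ, E) x) :
    ∃ X : VField E M, (∀ z, SmoothFieldAt X z) ∧ X x = v := by
  obtain ⟨s, hs⟩ := exists_contMDiffSection_forall_mem_convex_of_local 𝓘(ℝ, E) (n := ⊤)
    (F_fiber := E) (fun z : M ↦ TangentSpace 𝓘(ℝ, E) z)
    -- The convex condition is empty away from x and fixes the value at x; the zero field serves
    -- locally off x.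
    (fun z ↦ {w | z = x → w = FiberBundle.extend E v z}) (fun z ↦ by
      by_cases hz : z = x
      · simp [hz, convex_singleton]
      · simp [hz, convex_univ]) (fun z ↦ by
      by_cases hz : z = x
      · subst hz
        obtain ⟨U, hU, hsU⟩ := FiberBundle.exists_contMDiffOn_extend (k := ∞) 𝓘(ℝ, E) E v
        exact ⟨U, hU, _, hsU, fun _ _ _ ↦ rfl⟩
      · refine ⟨{x}ᶜ, isOpen_compl_singleton.mem_nhds hz, fun z ↦ 0, ?_, fun y hy h ↦ (hy h).elim⟩
        exact (contMDiff_zeroSection ℝ (TangentSpace 𝓘(ℝ, E))).contMDiffOn)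
  exact ⟨s, fun z ↦ s.contMDiff z, (hs x rfl).trans (FiberBundle.extend_apply_self E v)⟩

set_option synthInstance.maxHeartbeats 400000 in
set_option maxHeartbeats 1000000 in
-- Symmetric positive definite forms are a convex set, so local ones can be glued. Locally, a
-- Euclidean inner product on the model space is pulled back by a trivialization.
theorem exists_smooth_posDef_bilin :
    ∃ g : BField E M, (∀ x, ContDiffAt ℝ ∞ (bilInChart g x) (extChartAt 𝓘(ℝ, E) x x)) ∧
      (∀ x v w, g x v w = g x w v) ∧ ∀ x v, v ≠ 0 → 0 < g x v v := by
  let L := toEuclidean (E := E)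
  let c : E →L[ℝ] E →L[ℝ] ℝ :=
    (ContinuousLinearMap.precomp ℝ L.toContinuousLinearMap) ∘L (innerSL ℝ) ∘L
      L.toContinuousLinearMap
  have hc (u v : E) : c u v = inner ℝ (L u) (L v) := rfl
  obtain ⟨s, hs⟩ := exists_contMDiffSection_forall_mem_convex_of_local 𝓘(ℝ, E) (n := ⊤)
    (F_fiber := E →L[ℝ] E →L[ℝ] ℝ)
    (fun z : M ↦ TangentSpace 𝓘(ℝ, E) z →L[ℝ] TangentSpace 𝓘(ℝ, E) z →L[ℝ] ℝ)
    (fun z ↦ {B | (∀ v w, B v w = B w v) ∧ ∀ v, v ≠ 0 → 0 < B v v}) (fun z ↦ by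
      intro B hB B' hB' a b ha hb hab
      refine ⟨fun v w ↦ ?_, fun v hv ↦ ?_⟩
      · simp [hB.1 v w, hB'.1 v w]
      · have h1 := hB.2 v hv
        have h2 := hB'.2 v hv
        simp only [_root_.add_apply, _root_.smul_apply, smul_eq_mul]
        rcases ha.eq_or_lt with rfl | ha
        · have : b = 1 := by linarith
          simpa [this] using h2
        · have := mul_pos ha h1
          have := mul_nonneg hb h2.le
          linarith) (fun x₀ ↦ by
      let t := trivializationAt E (TangentSpace 𝓘(ℝ, E)) x₀
      let T := fun z : M ↦ t.continuousLinearMapAt ℝ z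
      refine ⟨t.baseSet, t.open_baseSet.mem_nhds (FiberBundle.mem_baseSet_trivializationAt' x₀),
        fun z ↦ (ContinuousLinearMap.precomp ℝ (T z)) ∘L c ∘L (T z), ?_, fun z hz ↦ ⟨?_, ?_⟩⟩
      · intro z hz
        have hz' : z ∈ (trivializationAt (E →L[ℝ] E →L[ℝ] ℝ) (fun z : M ↦
            TangentSpace 𝓘(ℝ, E) z →L[ℝ] TangentSpace 𝓘(ℝ, E) z →L[ℝ] ℝ) x₀).baseSet :=
          ⟨hz, hz, Set.mem_univ _⟩
        refine (Trivialization.contMDiffWithinAt_section (F := E →L[ℝ] E →L[ℝ] ℝ)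
          (E := fun z : M ↦ TangentSpace 𝓘(ℝ, E) z →L[ℝ] TangentSpace 𝓘(ℝ, E) z →L[ℝ] ℝ)
          (e := trivializationAt (E →L[ℝ] E →L[ℝ] ℝ) (fun z : M ↦
            TangentSpace 𝓘(ℝ, E) z →L[ℝ] TangentSpace 𝓘(ℝ, E) z →L[ℝ] ℝ) x₀) _ hz').2 ?_
        refine (contMDiffWithinAt_const (c := c)).congr_of_mem (fun y hy ↦ ?_) hz
        rw [hom_trivializationAt_apply]
        ext u v
        refine (inCoordinates_apply_eq₂ hy hy (Set.mem_univ _)).trans ?_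
        have hT (u : E) : T y (t.symm y u) = u := by
          rw [← t.symmL_apply (R := ℝ) hy]
          exact t.continuousLinearMapAt_symmL hy u
        have htriv (r : ℝ) : (trivializationAt ℝ (Bundle.Trivial M ℝ) x₀).linearMapAt ℝ y r = r := by
          simp
        refine (htriv _).trans ?_
        change c (T y (t.symm y u)) (T y (t.symm y v)) = c u v
        rw [hT, hT]
      · intro v w
        change c (T z v) (T z w) = c (T z w) (T z v)
        rw [hc, hc, real_inner_comm]
      · intro v hv
        change 0 < c (T z v) (T z v)
        rw [hc, real_inner_self_pos]
        intro h0
        refine hv ?_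
        rw [← t.symmL_continuousLinearMapAt (R := ℝ) hz v]
        have : T z v = 0 := L.injective (h0.trans (map_zero L).symm)
        change t.symmL ℝ z (T z v) = 0
        rw [this, map_zero])
  exact ⟨s, fun x ↦ contMDiffAt_bilin_iff.1 (s.contMDiff x), fun x ↦ (hs x).1, fun x ↦ (hs x).2⟩

end Existence

/-! ### The metric adapted to two transverse forms -/

section AdaptedMetric

universe u v

variable {E : Type u} [NormedAddCommGroup E] [NormedSpace ℝ E] [FiniteDimensional ℝ E]
  {M : Type v} [TopologicalSpace M] [ChartedSpace E M] [IsManifold 𝓘(ℝ, E) ∞ M]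

/-- The pullback of a field of bilinear forms by the projection onto `D₂` along `D₁`. -/
def projBil {D₁ D₂ : Distribution E M} (h : ∀ x, IsCompl (D₁ x) (D₂ x)) (g : BField E M) :
    BField E M :=
  fun x ↦ (ContinuousLinearMap.precomp ℝ (proj h x)) ∘L (g x) ∘L (proj h x)

theorem projBil_apply {D₁ D₂ : Distribution E M} (h : ∀ x, IsCompl (D₁ x) (D₂ x))
    (g : BField E M) (x : M) (v w : TangentSpace 𝓘(ℝ, E) x) :
    projBil h g x v w = g x (proj h x v) (proj h x w) := rfl

theorem bilInChart_projBil {D₁ D₂ : Distribution E M} (h : ∀ x, IsCompl (D₁ x) (D₂ x))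
    (g : BField E M) {x₀ : M} {y : E} (hy : y ∈ (extChartAt 𝓘(ℝ, E) x₀).target) (u v : E) :
    bilInChart (projBil h g) x₀ y u v =
      bilInChart g x₀ y (projInChart h x₀ y u) (projInChart h x₀ y v) := by
  rw [bilInChart_apply, bilInChart_apply, chartFrame_projInChart h hy,
    chartFrame_projInChart h hy, projBil_apply]

/-- A fixed basis of the model space, as a basis of the tangent space at `x`. -/
def tangentBasis (x : M) :
    Module.Basis (Fin (Module.finrank ℝ E)) ℝ (TangentSpace 𝓘(ℝ, E) x) :=
  Module.finBasis ℝ E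

/-- The quotient of the Gram determinants of two fields of bilinear forms. -/
def gramRatio (B H : BField E M) (x : M) : ℝ :=
  gramDet (B x).toBilinForm (tangentBasis x) / gramDet (H x).toBilinForm (tangentBasis x)

/-- The bases `tangentBasis` need not vary smoothly in a chart, but the ratio is basis independent,
so the chart frame may replace them. This yields smoothness. -/
theorem gramRatio_comp_symm (B H : BField E M) {x₀ : M} {y : E}
    (hy : y ∈ (extChartAt 𝓘(ℝ, E) x₀).target) :
    gramRatio B H ((extChartAt 𝓘(ℝ, E) x₀).symm y) =
      gramDet (bilInChart B x₀ y).toBilinForm (Module.finBasis ℝ E) /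
        gramDet (bilInChart H x₀ y).toBilinForm (Module.finBasis ℝ E) := by
  obtain ⟨S, hS⟩ := isInvertible_chartFrame hy
  obtain ⟨r, hr, hB⟩ := exists_gramDet_eq_mul
    (tangentBasis (E := E) ((extChartAt 𝓘(ℝ, E) x₀).symm y))
    ((Module.finBasis ℝ E).map S.toLinearEquiv)
  have key (B : BField E M) : gramDet (bilInChart B x₀ y).toBilinForm (Module.finBasis ℝ E) =
      r * gramDet (B ((extChartAt 𝓘(ℝ, E) x₀).symm y)).toBilinForm (tangentBasis _) := by
    rw [← hB, gramDet, gramDet]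
    congr 1
    ext i j
    simp only [Matrix.of_apply, Module.Basis.map_apply]
    change bilInChart B x₀ y _ _ = _
    rw [bilInChart_apply, ← hS]
    rfl
  rw [gramRatio, key, key, mul_div_mul_left _ _ hr]

theorem contDiffAt_gramRatio {B H : BField E M} {x₀ : M}
    (hB : ContDiffAt ℝ ∞ (bilInChart B x₀) (extChartAt 𝓘(ℝ, E) x₀ x₀))
    (hH : ContDiffAt ℝ ∞ (bilInChart H x₀) (extChartAt 𝓘(ℝ, E) x₀ x₀))
    (hne : ∀ v, (∀ w, H x₀ v w = 0) → v = 0) :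
    ContDiffAt ℝ ∞ (gramRatio B H ∘ (extChartAt 𝓘(ℝ, E) x₀).symm)
      (extChartAt 𝓘(ℝ, E) x₀ x₀) := by
  refine ContDiffAt.congr_of_eventuallyEq ((contDiffAt_gramDet hB (Module.finBasis ℝ E)).div
    (contDiffAt_gramDet hH (Module.finBasis ℝ E)) ?_) ?_
  · refine gramDet_ne_zero _ fun v hv ↦ hne v fun w ↦ ?_
    exact (bilInChart_self H x₀ v w).symm.trans (hv w)
  · filter_upwards [eventually_mem_extChartAt_target x₀] with y hy
    exact gramRatio_comp_symm B H hy

theorem contDiffAt_bilInChart_combination {f₁ f₂ : M → ℝ} {H₁ H₂ : BField E M} {x : M}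
    (hf₁ : ContDiffAt ℝ ∞ (f₁ ∘ (extChartAt 𝓘(ℝ, E) x).symm) (extChartAt 𝓘(ℝ, E) x x))
    (hf₂ : ContDiffAt ℝ ∞ (f₂ ∘ (extChartAt 𝓘(ℝ, E) x).symm) (extChartAt 𝓘(ℝ, E) x x))
    (hH₁ : ContDiffAt ℝ ∞ (bilInChart H₁ x) (extChartAt 𝓘(ℝ, E) x x))
    (hH₂ : ContDiffAt ℝ ∞ (bilInChart H₂ x) (extChartAt 𝓘(ℝ, E) x x)) :
    ContDiffAt ℝ ∞ (bilInChart (fun x ↦ f₁ x • H₁ x + f₂ x • H₂ x) x)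
      (extChartAt 𝓘(ℝ, E) x x) := by
  refine contDiffAt_bilin_of_apply fun u v ↦ ?_
  have h₁ := hf₁.mul (contDiffAt_bilin_apply hH₁ (contDiffAt_const (c := u))
    (contDiffAt_const (c := v)))
  have h₂ := hf₂.mul (contDiffAt_bilin_apply hH₂ (contDiffAt_const (c := u))
    (contDiffAt_const (c := v)))
  have e : (fun z ↦ bilInChart (fun x ↦ f₁ x • H₁ x + f₂ x • H₂ x) x z u v) = fun z ↦
      (f₁ ∘ (extChartAt 𝓘(ℝ, E) x).symm) z * bilInChart H₁ x z u v +
      (f₂ ∘ (extChartAt 𝓘(ℝ, E) x).symm) z * bilInChart H₂ x z u v := by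
    ext z
    rw [bilInChart_apply, _root_.add_apply, _root_.add_apply]
    rfl
  rw [e]
  exact h₁.add h₂

section Factor

variable {D₁ D₂ : Distribution E M}

/-- The conformal factor on `D₁` by which the metric `g` has to be multiplied in order to get the
volume form on `D₁` defined by `B₂`; here `p` is the rank of `D₁`. -/
def volFactor (h : ∀ x, IsCompl (D₁ x) (D₂ x)) (B₁ B₂ g : BField E M) (p : ℕ) (x : M) : ℝ :=
  (gramRatio (fun x ↦ B₁ x + B₂ x) (fun x ↦ projBil (fun x ↦ (h x).symm) g x + B₁ x) x ^ 2) ^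
    (1 / (2 * p) : ℝ)

/-- B₁ need not be definite, so positivity alone is not enough. Testing against the D₁-component of
v kills the B₁ term and gives v ∈ D₂; what remains is B₁(v, ·) = 0, which gives v ∈ D₁. -/
theorem eq_zero_of_projBil_add_eq_zero (h : ∀ x, IsCompl (D₁ x) (D₂ x)) {B₁ g : BField E M}
    (h₁ : IsTransverseForm B₁ D₁) (hpos : ∀ x v, v ≠ 0 → 0 < g x v v) (x : M)
    (v : TangentSpace 𝓘(ℝ, E) x)
    (hv : ∀ w, (projBil (fun x ↦ (h x).symm) g x + B₁ x) v w = 0) : v = 0 := by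
  set h' := fun x ↦ (h x).symm
  have m2 : proj h' x v = 0 := by
    by_contra hne
    have e := hv (proj h' x v)
    rw [_root_.add_apply, _root_.add_apply, projBil_apply,
      proj_of_mem h' x (proj_mem h' x v), h₁.right x _ (proj_mem h' x v), add_zero] at e
    exact (hpos x _ hne).ne' e
  have m1 : v ∈ D₁ x := by
    rw [h₁.mem_iff]
    intro w
    have e := hv w
    rw [_root_.add_apply, _root_.add_apply, projBil_apply, m2, map_zero, _root_.zero_apply,
      zero_add] at e
    exact e
  rw [← proj_of_mem h' x m1, m2]

theorem contDiffAt_projBil_add (h : ∀ x, IsCompl (D₁ x) (D₂ x)) {B₁ B₂ g : BField E M}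
    (h₁ : IsTransverseForm B₁ D₁) (h₂ : IsTransverseForm B₂ D₂)
    (hg : ∀ x, ContDiffAt ℝ ∞ (bilInChart g x) (extChartAt 𝓘(ℝ, E) x x)) (x : M) :
    ContDiffAt ℝ ∞ (bilInChart (projBil h g) x) (extChartAt 𝓘(ℝ, E) x x) := by
  refine contDiffAt_bilin_of_apply fun u v ↦ ?_
  have hP := contDiffAt_projInChart h h₁ h₂ x
  refine (contDiffAt_bilin_apply (hg x) (hP.clm_apply (contDiffAt_const (c := u)))
    (hP.clm_apply (contDiffAt_const (c := v)))).congr_of_eventuallyEq ?_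
  filter_upwards [eventually_mem_extChartAt_target x] with y hy
  exact bilInChart_projBil h g hy u v

theorem gramRatio_ne_zero (h : ∀ x, IsCompl (D₁ x) (D₂ x)) {B₁ B₂ g : BField E M}
    (h₁ : IsTransverseForm B₁ D₁) (h₂ : IsTransverseForm B₂ D₂)
    (hpos : ∀ x v, v ≠ 0 → 0 < g x v v) (x : M) :
    gramRatio (fun x ↦ B₁ x + B₂ x) (fun x ↦ projBil (fun x ↦ (h x).symm) g x + B₁ x) x ≠ 0 :=
  div_ne_zero
    (gramDet_ne_zero _ fun v hv ↦ eq_zero_of_add_apply_eq_zero h h₁ h₂ x v hv)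
    (gramDet_ne_zero _ fun v hv ↦ eq_zero_of_projBil_add_eq_zero h h₁ hpos x v hv)

theorem volFactor_pos (h : ∀ x, IsCompl (D₁ x) (D₂ x)) {B₁ B₂ g : BField E M}
    (h₁ : IsTransverseForm B₁ D₁) (h₂ : IsTransverseForm B₂ D₂)
    (hpos : ∀ x v, v ≠ 0 → 0 < g x v v) (p : ℕ) (x : M) : 0 < volFactor h B₁ B₂ g p x :=
  Real.rpow_pos_of_pos (sq_pos_of_ne_zero (gramRatio_ne_zero h h₁ h₂ hpos x)) _

theorem contDiffAt_volFactor (h : ∀ x, IsCompl (D₁ x) (D₂ x)) {B₁ B₂ g : BField E M}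
    (h₁ : IsTransverseForm B₁ D₁) (h₂ : IsTransverseForm B₂ D₂)
    (hg : ∀ x, ContDiffAt ℝ ∞ (bilInChart g x) (extChartAt 𝓘(ℝ, E) x x))
    (hpos : ∀ x v, v ≠ 0 → 0 < g x v v) (p : ℕ) (x : M) :
    ContDiffAt ℝ ∞ (volFactor h B₁ B₂ g p ∘ (extChartAt 𝓘(ℝ, E) x).symm)
      (extChartAt 𝓘(ℝ, E) x x) := by
  have hs : ContDiffAt ℝ ∞ (bilInChart (fun x ↦ B₁ x + B₂ x) x) (extChartAt 𝓘(ℝ, E) x x) := by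
    simp only [funext (bilInChart_add B₁ B₂ x)]
    exact (h₁.smooth x).add (h₂.smooth x)
  have ht : ContDiffAt ℝ ∞ (bilInChart (fun x ↦ projBil (fun x ↦ (h x).symm) g x + B₁ x) x)
      (extChartAt 𝓘(ℝ, E) x x) := by
    simp only [funext (bilInChart_add (projBil (fun x ↦ (h x).symm) g) B₁ x)]
    exact (contDiffAt_projBil_add (fun x ↦ (h x).symm) h₂ h₁ hg x).add (h₁.smooth x)
  have hc := contDiffAt_gramRatio hs ht
    (fun v hv ↦ eq_zero_of_projBil_add_eq_zero h h₁ hpos x v hv)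
  refine (hc.pow 2).rpow_const_of_ne ?_
  rw [Function.comp_apply, extChartAt_to_inv]
  exact pow_ne_zero 2 (gramRatio_ne_zero h h₁ h₂ hpos x)

theorem gramDet_smul {V ι : Type*} [AddCommGroup V] [Module ℝ V] [Fintype ι] [DecidableEq ι]
    (B : LinearMap.BilinForm ℝ V) (a : ℝ) (e : ι → V) :
    gramDet (a • B) e = a ^ Fintype.card ι * gramDet B e := by
  rw [gramDet, gramDet, ← Matrix.det_smul]
  rfl

/-- With r = det B₂ / det g on D₁, scaling g by f multiplies its squared Gram determinant by f^(2p),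
and f = (r²)^(1/(2p)) gives exactly r². -/
theorem gramDet_volFactor_smul (h : ∀ x, IsCompl (D₁ x) (D₂ x)) {B₁ B₂ g : BField E M}
    (h₁ : IsTransverseForm B₁ D₁) (h₂ : IsTransverseForm B₂ D₂)
    (hpos : ∀ x v, v ≠ 0 → 0 < g x v v) {p : ℕ} (x : M) (hp : Module.finrank ℝ (D₁ x) = p)
    (e : Fin p → TangentSpace 𝓘(ℝ, E) x) (he : ∀ i, e i ∈ D₁ x) :
    gramDet (volFactor h B₁ B₂ g p x • (g x).toBilinForm) e ^ 2 =
      gramDet (B₂ x).toBilinForm e ^ 2 := by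
  have key : gramRatio (fun x ↦ B₁ x + B₂ x)
      (fun x ↦ projBil (fun x ↦ (h x).symm) g x + B₁ x) x * gramDet (g x).toBilinForm e =
      gramDet (B₂ x).toBilinForm e := by
    set h' := fun x ↦ (h x).symm
    refine gramDet_div_mul_gramDet (h x) (B₁ := (B₁ x).toBilinForm) (B₂ := (B₂ x).toBilinForm)
      (fun v hv ↦ (h₁.mem_iff x v).1 hv) (h₁.right x) (fun v hv ↦ (h₂.mem_iff x v).1 hv)
      (h₂.right x) (fun v hv w hw ↦ ?_) (fun v hv w hw ↦ ?_) (fun v hv w hw ↦ ?_)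
      (fun v hv w hw ↦ ?_) (eq_zero_of_projBil_add_eq_zero h h₁ hpos x) (tangentBasis x) e he
      (by simp [hp])
    · change g x (proj h' x v) (proj h' x w) + B₁ x v w = _
      rw [proj_of_mem h' x hv, proj_of_mem h' x hw, (h₁.mem_iff x v).1 hv, add_zero]
      rfl
    · change g x (proj h' x v) (proj h' x w) + B₁ x v w = _
      rw [proj_eq_zero h' x hw, (h₁.mem_iff x v).1 hv, add_zero, map_zero]
    · change g x (proj h' x v) (proj h' x w) + B₁ x v w = _
      rw [proj_eq_zero h' x hv, h₁.right x w hw, add_zero, map_zero, _root_.zero_apply]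
    · change g x (proj h' x v) (proj h' x w) + B₁ x v w = _
      rw [proj_eq_zero h' x hv, map_zero, _root_.zero_apply, zero_add]
      rfl
  rw [gramDet_smul, Fintype.card_fin, mul_pow, ← key, mul_pow]
  -- In rank zero the exponent 1/(2p) is the default value 0, but the factor only enters to the
  -- power p = 0, and the Gram determinants of empty families are 1.
  rcases Nat.eq_zero_or_pos p with rfl | hp0
  · have h1 : gramDet (g x).toBilinForm e = 1 := by simp [gramDet]
    have h2 : gramDet (B₂ x).toBilinForm e = 1 := by simp [gramDet]
    rw [h1, h2, mul_one] at key
    rw [key]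
    simp
  · congr 1
    rw [volFactor, ← pow_mul, ← Real.rpow_natCast, ← Real.rpow_mul (by positivity)]
    have : (1 / (2 * p) : ℝ) * ((p * 2 : ℕ) : ℝ) = 1 := by
      have : (p : ℝ) ≠ 0 := by positivity
      push_cast
      field_simp
    rw [this, Real.rpow_one]

end Factor

variable [T2Space M] [SigmaCompactSpace M]

theorem exists_adapted_metric {D₁ D₂ : Distribution E M} (h : ∀ x, IsCompl (D₁ x) (D₂ x))
    {B₁ B₂ : BField E M} (h₁ : IsTransverseForm B₁ D₁) (h₂ : IsTransverseForm B₂ D₂) {p q : ℕ}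
    (hp : ∀ x, Module.finrank ℝ (D₁ x) = p) (hq : ∀ x, Module.finrank ℝ (D₂ x) = q) :
    ∃ g : Metric E M, (∀ x, ∀ v ∈ D₁ x, ∀ w ∈ D₂ x, g.inner x v w = 0) ∧
      (∀ (x : M) (e : Fin p → TangentSpace 𝓘(ℝ, E) x), (∀ i, e i ∈ D₁ x) →
        gramDet (g.inner x).toBilinForm e ^ 2 = gramDet (B₂ x).toBilinForm e ^ 2) ∧
      (∀ (x : M) (e : Fin q → TangentSpace 𝓘(ℝ, E) x), (∀ i, e i ∈ D₂ x) →
        gramDet (g.inner x).toBilinForm e ^ 2 = gramDet (B₁ x).toBilinForm e ^ 2) := by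
  obtain ⟨g₀, hsm, hsymm, hpos⟩ := exists_smooth_posDef_bilin (E := E) (M := M)
  set h' := fun x ↦ (h x).symm with hh'
  set f₁ := volFactor h B₁ B₂ g₀ p with hf₁
  set f₂ := volFactor h' B₂ B₁ g₀ q with hf₂
  have f₁pos := volFactor_pos h h₁ h₂ hpos p
  have f₂pos := volFactor_pos h' h₂ h₁ hpos q
  -- The mixed terms of `g₀` are dropped, which makes D₁ and D₂ orthogonal, and each block gets its
  -- own volume factor.
  let G : BField E M := fun x ↦ f₁ x • projBil h' g₀ x + f₂ x • projBil h g₀ x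
  have hG (x : M) (v w : TangentSpace 𝓘(ℝ, E) x) : G x v w =
      f₁ x * g₀ x (proj h' x v) (proj h' x w) + f₂ x * g₀ x (proj h x v) (proj h x w) := rfl
  have hGsm (x : M) : ContDiffAt ℝ ∞ (bilInChart G x) (extChartAt 𝓘(ℝ, E) x x) := by
    exact contDiffAt_bilInChart_combination (contDiffAt_volFactor h h₁ h₂ hsm hpos p x)
      (contDiffAt_volFactor h' h₂ h₁ hsm hpos q x) (contDiffAt_projBil_add h' h₂ h₁ hsm x)
      (contDiffAt_projBil_add h h₁ h₂ hsm x)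
  have hGpos (x : M) (v : TangentSpace 𝓘(ℝ, E) x) (hv : v ≠ 0) : 0 < G x v v := by
    rw [hG]
    have nn (w : TangentSpace 𝓘(ℝ, E) x) : 0 ≤ g₀ x w w := by
      rcases eq_or_ne w 0 with rfl | hw
      · rw [map_zero]
      · exact (hpos x w hw).le
    by_cases h2 : proj h x v = 0
    · have h1 : proj h' x v ≠ 0 := by
        rw [proj_symm h, h2, sub_zero]
        exact hv
      have := mul_pos (f₁pos x) (hpos x _ h1)
      have := mul_nonneg (f₂pos x).le (nn (proj h x v))
      linarith
    · have := mul_pos (f₂pos x) (hpos x _ h2)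
      have := mul_nonneg (f₁pos x).le (nn (proj h' x v))
      linarith
  let g : Metric E M :=
    { inner := G
      symm := fun x v w ↦ by
        rw [hG, hG, hsymm x (proj h' x v), hsymm x (proj h x v)]
      pos := hGpos
      isVonNBounded := fun x ↦ isVonNBounded_of_posDef (E := E) (hGpos x)
      contMDiff := fun x ↦ contMDiffAt_bilin_iff.2 (hGsm x) }
  have hgram {n : ℕ} (B B' : BField E M) (D : Distribution E M) (x : M)
      (hB : ∀ v ∈ D x, ∀ w ∈ D x, B x v w = B' x v w) (e : Fin n → TangentSpace 𝓘(ℝ, E) x)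
      (he : ∀ i, e i ∈ D x) : gramDet (B x).toBilinForm e = gramDet (B' x).toBilinForm e := by
    rw [gramDet, gramDet]
    congr 1
    ext i j
    exact hB _ (he i) _ (he j)
  refine ⟨g, fun x v hv w hw ↦ ?_, fun x e he ↦ ?_, fun x e he ↦ ?_⟩
  · change G x v w = 0
    rw [hG, proj_eq_zero h x hv, proj_eq_zero h' x hw]
    simp
  · rw [← gramDet_volFactor_smul h h₁ h₂ hpos x (hp x) e he]
    congr 1
    refine hgram G (fun x ↦ f₁ x • g₀ x) D₁ x (fun v hv w hw ↦ ?_) e he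
    rw [hG, proj_of_mem h' x hv, proj_of_mem h' x hw, proj_eq_zero h x hv]
    simp
  · rw [← gramDet_volFactor_smul h' h₂ h₁ hpos x (hq x) e he]
    congr 1
    refine hgram G (fun x ↦ f₂ x • g₀ x) D₂ x (fun v hv w hw ↦ ?_) e he
    rw [hG, proj_of_mem h x hv, proj_of_mem h x hw, proj_eq_zero h' x hv]
    simp

end AdaptedMetric

/-! ### Minimality of the leaves -/

theorem eq_sum_smul_of_orthonormal {V : Type*} [AddCommGroup V] [Module ℝ V]
    [FiniteDimensional ℝ V] {B : LinearMap.BilinForm ℝ V} {D : Submodule ℝ V} {p : ℕ}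
    {e : Fin p → V} (hD : Module.finrank ℝ D = p) (he : ∀ i, e i ∈ D)
    (hee : ∀ i j, B (e i) (e j) = if i = j then 1 else 0) {u : V} (hu : u ∈ D) :
    u = ∑ i, B u (e i) • e i := by
  have coef (c : Fin p → ℝ) (i : Fin p) : B (∑ j, c j • e j) (e i) = c i := by
    simp [hee]
  have hli : LinearIndependent ℝ e := by
    rw [Fintype.linearIndependent_iff]
    intro c hc i
    rw [← coef c i, hc, map_zero, LinearMap.zero_apply]
  have hspan : Submodule.span ℝ (Set.range e) = D := by
    refine Submodule.eq_of_le_of_finrank_eq (Submodule.span_le.2 ?_) ?_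
    · rintro _ ⟨i, rfl⟩
      exact he i
    · rw [finrank_span_eq_card hli, Fintype.card_fin, hD]
  rw [← hspan, Submodule.mem_span_range_iff_exists_fun] at hu
  obtain ⟨c, rfl⟩ := hu
  simp only [coef]

theorem fderiv_bilin_projection {E : Type*} [NormedAddCommGroup E] [NormedSpace ℝ E]
    {b : E → E →L[ℝ] E →L[ℝ] ℝ} {P : E → E →L[ℝ] E} {X : E → E} {y : E}
    (hb : DifferentiableAt ℝ b y) (hP : DifferentiableAt ℝ P y) (hX : DifferentiableAt ℝ X y)
    {u n : E} (hu : X y = u) (hn : P y n = n) :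
    fderiv ℝ (fun z ↦ b z (X z) (P z n)) y u =
      fderiv ℝ b y u u n + b y (fderiv ℝ X y u) n + b y u (fderiv ℝ P y u n) := by
  rw [fderiv_bilin_apply hb hX (hP.clm_apply (differentiableAt_const n)),
    fderiv_clm_apply hP (differentiableAt_const n), hu, hn]
  simp

section Minimal

universe u v

variable {E : Type u} [NormedAddCommGroup E] [NormedSpace ℝ E] [FiniteDimensional ℝ E]
  {M : Type v} [TopologicalSpace M] [ChartedSpace E M] [IsManifold 𝓘(ℝ, E) ∞ M]

theorem Metric.contDiffAt_bilInChart (g : Metric E M) (x : M) :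
    ContDiffAt ℝ ∞ (bilInChart (fun x ↦ g.inner x) x) (extChartAt 𝓘(ℝ, E) x x) :=
  contMDiffAt_bilin_iff.1 (g.contMDiff x)

theorem Metric.mvfderiv_inner (g : Metric E M) {X Y : VField E M} {x : M}
    (hX : SmoothFieldAt X x) (hY : SmoothFieldAt Y x) (v : E) :
    mvfderiv 𝓘(ℝ, E) (fun z ↦ g.inner z (X z) (Y z)) x v =
      fderiv ℝ (bilInChart (fun x ↦ g.inner x) x) (extChartAt 𝓘(ℝ, E) x x) v (X x) (Y x) +
        g.inner x (fderiv ℝ (vecInChart X x) (extChartAt 𝓘(ℝ, E) x x) v) (Y x) +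
        g.inner x (X x) (fderiv ℝ (vecInChart Y x) (extChartAt 𝓘(ℝ, E) x x) v) := by
  have e : (fun z ↦ g.inner z (X z) (Y z)) ∘ (extChartAt 𝓘(ℝ, E) x).symm
      =ᶠ[𝓝 (extChartAt 𝓘(ℝ, E) x x)] fun y ↦ bilInChart (fun x ↦ g.inner x) x y
        (vecInChart X x y) (vecInChart Y x y) := by
    filter_upwards [eventually_mem_extChartAt_target x] with y hy
    exact (bilInChart_vecInChart (fun x ↦ g.inner x) X Y hy).symm
  have hg := g.contDiffAt_bilInChart x
  have hX' := smoothFieldAt_iff.1 hX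
  have hY' := smoothFieldAt_iff.1 hY
  have hs := (contDiffAt_bilin_apply hg hX' hY').congr_of_eventuallyEq e
  refine (mvfderiv_eq_fderiv (contMDiffAt_iff_contDiffAt_chart.2 hs) v).trans ?_
  rw [e.fderiv_eq]
  refine (fderiv_bilin_apply (differentiableAt_of_smooth hg) (differentiableAt_of_smooth hX')
    (differentiableAt_of_smooth hY') v).trans ?_
  rw [vecInChart_self, vecInChart_self]
  exact congrArg₂ (· + ·) (congrArg₂ (· + ·) rfl (bilInChart_self _ x _ _))
    (bilInChart_self _ x _ _)

/-- In the Koszul formula for g(∇_X X, N) the derivatives of N cancel, so only N x matters and N may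
be replaced by any convenient extension. -/
theorem Metric.leviCivita_self_left (g : Metric E M) {X N : VField E M} {x : M}
    (hX : SmoothFieldAt X x) (hN : SmoothFieldAt N x) :
    g.leviCivita X X N x =
      fderiv ℝ (bilInChart (fun x ↦ g.inner x) x) (extChartAt 𝓘(ℝ, E) x x) (X x) (X x) (N x) +
        g.inner x (fderiv ℝ (vecInChart X x) (extChartAt 𝓘(ℝ, E) x x) (X x)) (N x) -
        fderiv ℝ (bilInChart (fun x ↦ g.inner x) x) (extChartAt 𝓘(ℝ, E) x x) (N x) (X x) (X x) / 2
      := by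
  have hbr : VectorField.mlieBracket 𝓘(ℝ, E) X N x =
      (fderiv ℝ (vecInChart N x) (extChartAt 𝓘(ℝ, E) x x) (X x) -
        fderiv ℝ (vecInChart X x) (extChartAt 𝓘(ℝ, E) x x) (N x) : E) := by
    refine (mlieBracket_eq_lieBracket X N x).trans ?_
    rw [VectorField.lieBracket, vecInChart_self, vecInChart_self]
  have hsub (u v : E) (w : TangentSpace 𝓘(ℝ, E) x) :
      g.inner x (u - v : E) w = g.inner x u w - g.inner x v w := by
    exact congrArg (fun L : TangentSpace 𝓘(ℝ, E) x →L[ℝ] ℝ ↦ L w) (map_sub (g.inner x) u v)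
  have h0 : g.inner x (VectorField.mlieBracket 𝓘(ℝ, E) X X x) (N x) = 0 := by
    rw [VectorField.mlieBracket_self, Pi.zero_apply, map_zero, _root_.zero_apply]
  have hb : g.inner x (VectorField.mlieBracket 𝓘(ℝ, E) X N x) (X x) =
      g.inner x (X x) (fderiv ℝ (vecInChart N x) (extChartAt 𝓘(ℝ, E) x x) (X x)) -
      g.inner x (X x) (fderiv ℝ (vecInChart X x) (extChartAt 𝓘(ℝ, E) x x) (N x)) := by
    rw [hbr]
    exact (hsub _ _ _).trans (congrArg₂ (· - ·) (g.symm x _ _) (g.symm x _ _))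
  have h1 := g.mvfderiv_inner hX hN (X x)
  have h2 := g.mvfderiv_inner hX hX (N x)
  have hs := g.symm x (X x) (fderiv ℝ (vecInChart X x) (extChartAt 𝓘(ℝ, E) x x) (N x))
  rw [Metric.leviCivita, h1, h2, h0, hb]
  linarith

/-- Constant chart vectors leave D₁ away from the centre. B₂ ignores their D₂-components, while for
g they must be projected back to D₁ before the determinants can be compared. -/
theorem Metric.sq_det_bilInChart (g : Metric E M) {D₁ D₂ : Distribution E M}
    (h : ∀ x, IsCompl (D₁ x) (D₂ x)) {B₂ : BField E M} (h₂ : IsTransverseForm B₂ D₂) {p : ℕ}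
    (hdet : ∀ (x : M) (e : Fin p → TangentSpace 𝓘(ℝ, E) x), (∀ i, e i ∈ D₁ x) →
      gramDet (g.inner x).toBilinForm e ^ 2 = gramDet (B₂ x).toBilinForm e ^ 2)
    {x : M} {z : E} (hz : z ∈ (extChartAt 𝓘(ℝ, E) x).target) (e : Fin p → E) :
    (Matrix.of fun i j ↦ bilInChart B₂ x z (e i) (e j)).det ^ 2 =
      (Matrix.of fun i j ↦ bilInChart (fun x ↦ g.inner x) x z (e i - projInChart h x z (e i))
        (e j - projInChart h x z (e j))).det ^ 2 := by
  have := hdet _ (fun i ↦ chartFrame E x z (e i) - proj h _ (chartFrame E x z (e i)))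
    fun i ↦ sub_proj_mem h _ _
  rw [gramDet, gramDet] at this
  refine (Eq.trans ?_ this.symm).trans ?_
  · congr 2
    ext i j
    simp only [Matrix.of_apply]
    change bilInChart B₂ x z _ _ = B₂ _ (_ - _) (_ - _)
    rw [map_sub, map_sub, _root_.sub_apply, _root_.sub_apply,
      (h₂.mem_iff _ _).1 (proj_mem h _ _), (h₂.mem_iff _ _).1 (proj_mem h _ _),
      h₂.right _ _ (proj_mem h _ _), sub_zero, sub_zero, sub_zero, bilInChart_apply]
  · congr 2
    ext i j
    simp only [Matrix.of_apply]
    change g.inner _ (_ - _) (_ - _) = bilInChart (fun x ↦ g.inner x) x z _ _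
    rw [bilInChart_apply, map_sub (chartFrame E x z), chartFrame_projInChart h hz,
      map_sub (chartFrame E x z), chartFrame_projInChart h hz]

/-- Tangency of the `e i` away from x enters only through `hF`: the derivative of g(e i, P N) along
`e i` itself. This serves both for fields tangent near x and for fields tangent only along one leaf.
-/
theorem Metric.sum_leviCivita_eq_zero (g : Metric E M) {D₁ D₂ : Distribution E M}
    (h : ∀ x, IsCompl (D₁ x) (D₂ x))
    {B₁ B₂ : BField E M} (h₁ : IsTransverseForm B₁ D₁) (h₂ : IsTransverseForm B₂ D₂) {p : ℕ}
    (horth : ∀ x, ∀ v ∈ D₁ x, ∀ w ∈ D₂ x, g.inner x v w = 0)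
    (hdet : ∀ (x : M) (e : Fin p → TangentSpace 𝓘(ℝ, E) x), (∀ i, e i ∈ D₁ x) →
      gramDet (g.inner x).toBilinForm e ^ 2 = gramDet (B₂ x).toBilinForm e ^ 2)
    {x : M} (hp : Module.finrank ℝ (D₁ x) = p) {e : Fin p → VField E M} {N : VField E M}
    (hes : ∀ i, SmoothFieldAt (e i) x) (heD : ∀ i, e i x ∈ D₁ x)
    (hee : ∀ i j, g.inner x (e i x) (e j x) = if i = j then 1 else 0)
    (hN : SmoothFieldAt N x) (hNe : ∀ i, g.inner x (e i x) (N x) = 0)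
    (hF : ∀ i, fderiv ℝ (fun z ↦ bilInChart (fun x ↦ g.inner x) x z (vecInChart (e i) x z)
      (projInChart h x z (N x))) (extChartAt 𝓘(ℝ, E) x x) (e i x) = 0) :
    ∑ i, g.leviCivita (e i) (e i) N x = 0 := by
  set y := extChartAt 𝓘(ℝ, E) x x with hy
  set b := bilInChart (fun x ↦ g.inner x) x with hb
  have hspan (u : TangentSpace 𝓘(ℝ, E) x) (hu : u ∈ D₁ x) :
      u = ∑ i, g.inner x u (e i x) • e i x :=
    eq_sum_smul_of_orthonormal (B := (g.inner x).toBilinForm) hp heD hee hu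
  -- The D₁-component of N is orthogonal to an orthonormal basis of D₁, so N lies in D₂.
  have hND : proj h x (N x) = N x := by
    have hw := hspan _ (sub_proj_mem h x (N x))
    have h0 (i : Fin p) : g.inner x (N x - proj h x (N x)) (e i x) = 0 := by
      rw [g.symm, map_sub, hNe, horth x _ (heD i) _ (proj_mem h x _), sub_zero]
    simp only [h0, zero_smul, Finset.sum_const_zero] at hw
    exact (sub_eq_zero.1 hw).symm
  have hND₂ : N x ∈ D₂ x := hND ▸ proj_mem h x (N x)
  have hPN : projInChart h x y (N x) = N x := (projInChart_self h x (N x)).trans hND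
  have hPe (i : Fin p) : projInChart h x y (e i x) = 0 :=
    (projInChart_self h x (e i x)).trans (proj_eq_zero h x (heD i))
  have hbd := differentiableAt_of_smooth (g.contDiffAt_bilInChart x)
  have hPd := differentiableAt_of_smooth (contDiffAt_projInChart h h₁ h₂ x)
  -- Expanding `hF` by the product rule expresses g(D_{e i} e i, N) through the derivatives of g and
  -- P, so the derivatives of `e i` disappear.
  have hLC (i : Fin p) : g.leviCivita (e i) (e i) N x =
      -(b y (e i x) (fderiv ℝ (projInChart h x) y (e i x) (N x)) +
        fderiv ℝ b y (N x) (e i x) (e i x) / 2) := by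
    have h1 := (fderiv_bilin_projection hbd hPd
      (differentiableAt_of_smooth (smoothFieldAt_iff.1 (hes i))) (vecInChart_self (e i) x)
      hPN).symm.trans (hF i)
    have h2 := g.leviCivita_self_left (hes i) hN
    have h3 := bilInChart_self (fun x ↦ g.inner x) x
      (fderiv ℝ (vecInChart (e i) x) (extChartAt 𝓘(ℝ, E) x x) (e i x)) (N x)
    have arith {a b b' c d l : ℝ} (h1 : a + b' + c = 0) (h2 : l = a + b - d / 2)
        (h3 : b' = b) : l = -(c + d / 2) := by linarith
    exact arith h1 h2 h3
  refine (Finset.sum_congr rfl fun i _ ↦ hLC i).trans ?_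
  rw [Finset.sum_neg_distrib, neg_eq_zero]
  have target := eventually_mem_extChartAt_target (E := E) x
  have hB₂d := differentiableAt_of_smooth (h₂.smooth x)
  refine sum_secondFundamentalForm_eq_zero (b := bilInChart B₂ x) (g := b)
    (P := projInChart h x) hB₂d hbd hPd ?_ ?_ ?_ ?_ ?_ hPN
    hPe ?_ ?_ ?_ (h₂.inv x (N x) hND₂)
  · filter_upwards [target] with z hz u w
    rw [bilInChart_apply, chartFrame_projInChart h hz]
    exact (h₂.mem_iff _ _).1 (proj_mem h _ _) _
  · filter_upwards [target] with z hz u w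
    rw [bilInChart_apply, chartFrame_projInChart h hz]
    exact h₂.right _ _ (proj_mem h _ _) _
  · filter_upwards [target] with z hz u
    apply (isInvertible_chartFrame hz).bijective.1
    rw [chartFrame_projInChart h hz, chartFrame_projInChart h hz,
      proj_of_mem h _ (proj_mem h _ _)]
  · filter_upwards [target] with z hz u w
    rw [bilInChart_apply, map_sub, chartFrame_projInChart h hz, chartFrame_projInChart h hz]
    exact horth _ _ (sub_proj_mem h _ _) _ (proj_mem h _ _)
  · intro u w
    exact (bilInChart_self _ x u w).trans ((g.symm x u w).trans (bilInChart_self _ x w u).symm)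
  · intro i j
    exact (bilInChart_self _ x _ _).trans (hee i j)
  · intro u hu
    have hu' : u ∈ D₁ x := by
      have := sub_proj_mem h x u
      rw [← projInChart_self h x u, ← hy, hu] at this
      exact (sub_zero u) ▸ this
    refine (hspan u hu').trans (Finset.sum_congr rfl fun i _ ↦ ?_)
    exact congrArg (fun r : ℝ ↦ r • (e i x : E)) (bilInChart_self _ x u (e i x)).symm
  · filter_upwards [target] with z hz
    exact g.sq_det_bilInChart h h₂ hdet hz fun i ↦ e i x

theorem Metric.hasMinimalLeaves (g : Metric E M) {D₁ D₂ : Distribution E M}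
    (h : ∀ x, IsCompl (D₁ x) (D₂ x))
    {B₁ B₂ : BField E M} (h₁ : IsTransverseForm B₁ D₁) (h₂ : IsTransverseForm B₂ D₂) {p : ℕ}
    (hp : ∀ x, Module.finrank ℝ (D₁ x) = p)
    (horth : ∀ x, ∀ v ∈ D₁ x, ∀ w ∈ D₂ x, g.inner x v w = 0)
    (hdet : ∀ (x : M) (e : Fin p → TangentSpace 𝓘(ℝ, E) x), (∀ i, e i ∈ D₁ x) →
      gramDet (g.inner x).toBilinForm e ^ 2 = gramDet (B₂ x).toBilinForm e ^ 2) :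
    HasMinimalLeaves g D₁ := by
  have hzero {x : M} {X : VField E M} {z : E} (u : E)
      (hz : z ∈ (extChartAt 𝓘(ℝ, E) x).target)
      (hX : X ((extChartAt 𝓘(ℝ, E) x).symm z) ∈ D₁ ((extChartAt 𝓘(ℝ, E) x).symm z)) :
      bilInChart (fun x ↦ g.inner x) x z (vecInChart X x z) (projInChart h x z u) = 0 := by
    rw [bilInChart_apply, chartFrame_projInChart h hz, chartFrame_vecInChart X hz]
    exact horth _ _ hX _ (proj_mem h _ _)
  refine ⟨fun x e N hes het hee hN hNe ↦ ?_, fun q L _ _ _ f hf y e N hes het hee hN hNe ↦ ?_⟩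
  · obtain rfl := hp x
    refine g.sum_leviCivita_eq_zero h h₁ h₂ horth hdet rfl hes
      (fun i ↦ (het i).self_of_nhds) hee hN hNe fun i ↦ ?_
    have : (fun z ↦ bilInChart (fun x ↦ g.inner x) x z (vecInChart (e i) x z)
        (projInChart h x z (N x))) =ᶠ[𝓝 (extChartAt 𝓘(ℝ, E) x x)] fun _ ↦ 0 := by
      filter_upwards [eventually_mem_extChartAt_target x,
        (tendsto_extChartAt_symm x).eventually (het i)] with z hz hz'
      exact hzero _ hz hz'
    rw [this.fderiv_eq, fderiv_const_apply]
    rfl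
  -- An immersed integral manifold has the rank of D₁ as its dimension.
  · have hq : q = p := by
      have e1 := LinearMap.finrank_range_of_inj (f := (mfderiv (𝓡 q) 𝓘(ℝ, E) f y).toLinearMap)
        (hf.injective y)
      have e2 := hf.range_eq y
      rw [← hp (f y), ← e2]
      refine Eq.trans ?_ e1.symm
      exact (finrank_euclideanSpace_fin (𝕜 := ℝ) (n := q)).symm
    subst hq
    have hfy (i : Fin q) : e i (f y) ∈ (mfderiv (𝓡 q) 𝓘(ℝ, E) f y).range :=
      (het i).self_of_nhds
    refine g.sum_leviCivita_eq_zero h h₁ h₂ horth hdet (hp _) hes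
      (fun i ↦ hf.range_eq y ▸ hfy i) hee hN hNe fun i ↦ ?_
    set x := f y with hx
    set F : E → ℝ := fun z ↦ bilInChart (fun x ↦ g.inner x) x z (vecInChart (e i) x z)
        (projInChart h x z (N x)) with hFdef
    have hFd : DifferentiableAt ℝ F (extChartAt 𝓘(ℝ, E) x x) :=
      differentiableAt_of_smooth (contDiffAt_bilin_apply (g.contDiffAt_bilInChart x)
        (smoothFieldAt_iff.1 (hes i))
        ((contDiffAt_projInChart h h₁ h₂ x).clm_apply contDiffAt_const))
    have hfd : HasMFDerivAt (𝓡 q) 𝓘(ℝ, E) f y (mfderiv (𝓡 q) 𝓘(ℝ, E) f y) :=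
      ((hf.smooth y).mdifferentiableAt (by simp)).hasMFDerivAt
    have hφ : HasMFDerivAt 𝓘(ℝ, E) 𝓘(ℝ, E) (extChartAt 𝓘(ℝ, E) x) x
        (ContinuousLinearMap.id ℝ E) := by
      have := (mdifferentiableAt_extChartAt (I := 𝓘(ℝ, E)) (mem_chart_source E x)).hasMFDerivAt
      rw [mfderiv_extChartAt_self] at this
      exact this
    have hcomp := (hFd.hasFDerivAt.hasMFDerivAt.comp x hφ).comp y hfd
    -- F need not vanish near x, only along the leaf; since `e i` is the image of some u under the
    -- differential of f, the chain rule still kills the derivative of F along it.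
    have hev : (F ∘ extChartAt 𝓘(ℝ, E) x) ∘ f =ᶠ[𝓝 y] fun _ ↦ (0 : ℝ) := by
      have hc : Filter.Tendsto f (𝓝 y) (𝓝 x) := (hf.smooth y).continuousAt
      filter_upwards [het i, hc.eventually (extChartAt_source_mem_nhds (I := 𝓘(ℝ, E)) x)]
        with z hz hz'
      have hl := (extChartAt 𝓘(ℝ, E) x).left_inv hz'
      refine hzero _ ((extChartAt 𝓘(ℝ, E) x).map_source hz') ?_
      rw [hl, ← hf.range_eq z]
      exact hz
    obtain ⟨u, hu⟩ := hfy i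
    have h0 := (hcomp.congr_of_eventuallyEq hev.symm).mfderiv.symm.trans mfderiv_const
    have h1 := congrArg (fun L : TangentSpace (𝓡 q) y →L[ℝ] ℝ ↦ L u) h0
    rw [← hu]
    exact h1

end Minimal

/-! ### The criterion for transverse forms -/

section Criterion

universe u v

variable {E : Type u} [NormedAddCommGroup E] [NormedSpace ℝ E] [FiniteDimensional ℝ E]
  {M : Type v} [TopologicalSpace M] [ChartedSpace E M] [IsManifold 𝓘(ℝ, E) ∞ M]
  {D₁ D₂ : Distribution E M} {B₁ B₂ : BField E M}

theorem smoothFieldAt_proj (h : ∀ x, IsCompl (D₁ x) (D₂ x)) (h₁ : IsTransverseForm B₁ D₁)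
    (h₂ : IsTransverseForm B₂ D₂) {X : VField E M} {x : M} (hX : SmoothFieldAt X x) :
    SmoothFieldAt (fun z ↦ proj h z (X z)) x := by
  rw [smoothFieldAt_iff] at hX ⊢
  refine ((contDiffAt_projInChart h h₁ h₂ x).clm_apply hX).congr_of_eventuallyEq ?_
  filter_upwards [eventually_mem_extChartAt_target x] with y hy
  apply (isInvertible_chartFrame hy).bijective.1
  rw [chartFrame_projInChart h hy, chartFrame_vecInChart _ hy, chartFrame_vecInChart _ hy]

variable [T2Space M] [SigmaCompactSpace M]

theorem isFoliation_of_isTransverseForm (h : ∀ x, IsCompl (D₁ x) (D₂ x))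
    (h₁ : IsTransverseForm B₁ D₁) (h₂ : IsTransverseForm B₂ D₂) {p : ℕ}
    (hp : ∀ x, Module.finrank ℝ (D₁ x) = p) : IsFoliation D₁ where
  constant_rank := ⟨p, hp⟩
  smooth x v hv := by
    obtain ⟨X, hX, hXv⟩ := exists_smoothField x v
    refine ⟨fun z ↦ proj (fun x ↦ (h x).symm) z (X z), fun z ↦ smoothFieldAt_proj _ h₂ h₁ (hX z),
      fun z ↦ proj_mem _ _ _, ?_⟩
    exact (congrArg _ hXv).trans (proj_of_mem _ _ hv)
  involutive := h₁.involutive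

/-- Complementary distributions of constant rank that are kernels of fields of bilinear forms
invariant along their kernels are orthogonal foliations with minimal leaves for some metric. -/
theorem admitOrthogonalMinimalMetric_of_isTransverseForm (h : ∀ x, IsCompl (D₁ x) (D₂ x))
    (h₁ : IsTransverseForm B₁ D₁) (h₂ : IsTransverseForm B₂ D₂) {p q : ℕ}
    (hp : ∀ x, Module.finrank ℝ (D₁ x) = p) (hq : ∀ x, Module.finrank ℝ (D₂ x) = q) :
    AdmitOrthogonalMinimalMetric D₁ D₂ := by
  obtain ⟨g, horth, hdet₁, hdet₂⟩ := exists_adapted_metric h h₁ h₂ hp hq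
  refine ⟨isFoliation_of_isTransverseForm h h₁ h₂ hp,
    isFoliation_of_isTransverseForm (fun x ↦ (h x).symm) h₂ h₁ hq, h, g, horth,
    g.hasMinimalLeaves h h₁ h₂ hp horth hdet₁,
    g.hasMinimalLeaves (fun x ↦ (h x).symm) h₂ h₁ hq (fun x v hv w hw ↦ ?_) hdet₂⟩
  rw [g.symm]
  exact horth x w hw v hv

end Criterion

/-! ### Chart independence of the exterior derivative -/

theorem minSmoothness_two_le : minSmoothness ℝ 2 ≤ (∞ : WithTop ℕ∞) := by
  rw [minSmoothness_of_isRCLikeNormedField]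
  exact ENat.LEInfty.out

section Naturality

universe u v

variable {E : Type u} [NormedAddCommGroup E] [NormedSpace ℝ E]
  {M : Type v} [TopologicalSpace M] [ChartedSpace E M]

theorem formInChart_apply {n : ℕ} (η : DForm E M n) (x₀ : M) (y : E) (u : Fin n → E) :
    formInChart η x₀ y u = η ((extChartAt 𝓘(ℝ, E) x₀).symm y) (fun i ↦ chartFrame E x₀ y (u i)) :=
  rfl

theorem form_apply_congr {n : ℕ} (η : DForm E M n) {x x' : M} (hx : x = x') {v v' : Fin n → E}
    (hv : v = v') : (η x : E [⋀^Fin n]→L[ℝ] ℝ) v = (η x' : E [⋀^Fin n]→L[ℝ] ℝ) v' := by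
  subst hx hv
  rfl

theorem IsSmoothForm.contDiffAt {n : ℕ} {η : DForm E M n} (hη : IsSmoothForm η) {x : M} {y : E}
    (hy : y ∈ (extChartAt 𝓘(ℝ, E) x).target) : ContDiffAt ℝ ∞ (formInChart η x) y :=
  (hη x).contDiffAt ((isOpen_extChartAt_target x).mem_nhds hy)

variable [IsManifold 𝓘(ℝ, E) ∞ M]

theorem extDer_eq_extDeriv {n : ℕ} (η : DForm E M n) (x : M) :
    (extDer η x : E [⋀^Fin (n + 1)]→L[ℝ] ℝ) =
      extDeriv (formInChart η x) (extChartAt 𝓘(ℝ, E) x x) := by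
  ext v
  have h : ∀ u : E, (mfderiv 𝓘(ℝ, E) 𝓘(ℝ, E) (extChartAt 𝓘(ℝ, E) x) x : E →L[ℝ] E) u = u := by
    intro u
    rw [mfderiv_extChartAt_self]
    rfl
  refine congrArg (extDeriv (formInChart η x) (extChartAt 𝓘(ℝ, E) x x)) ?_
  ext i
  exact h _

section Transition

variable {x₀ x' : M}

theorem fderiv_transition {z : E} (hz : z ∈ (extChartAt 𝓘(ℝ, E) x₀).target)
    (hz' : (extChartAt 𝓘(ℝ, E) x₀).symm z ∈ (extChartAt 𝓘(ℝ, E) x').source) (u : E) :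
    fderiv ℝ (extChartAt 𝓘(ℝ, E) x' ∘ (extChartAt 𝓘(ℝ, E) x₀).symm) z u =
      mfderiv 𝓘(ℝ, E) 𝓘(ℝ, E) (extChartAt 𝓘(ℝ, E) x') ((extChartAt 𝓘(ℝ, E) x₀).symm z)
        (chartFrame E x₀ z u) := by
  rw [extChartAt_source] at hz'
  have h1 := mdifferentiableAt_extChartAt (I := 𝓘(ℝ, E)) hz'
  have h2 : MDifferentiableAt 𝓘(ℝ, E) 𝓘(ℝ, E) (extChartAt 𝓘(ℝ, E) x₀).symm z := by
    have := mdifferentiableWithinAt_extChartAt_symm (I := 𝓘(ℝ, E)) hz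
    rwa [modelWithCornersSelf_coe, Set.range_id, mdifferentiableWithinAt_univ] at this
  rw [← mfderiv_eq_fderiv, mfderiv_comp z h1 h2]
  rfl

theorem formInChart_transition {n : ℕ} (η : DForm E M n) {z : E}
    (hz : z ∈ (extChartAt 𝓘(ℝ, E) x₀).target)
    (hz' : (extChartAt 𝓘(ℝ, E) x₀).symm z ∈ (extChartAt 𝓘(ℝ, E) x').source) :
    formInChart η x₀ z = (formInChart η x'
      ((extChartAt 𝓘(ℝ, E) x' ∘ (extChartAt 𝓘(ℝ, E) x₀).symm) z)).compContinuousLinearMap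
        (fderiv ℝ (extChartAt 𝓘(ℝ, E) x' ∘ (extChartAt 𝓘(ℝ, E) x₀).symm) z) := by
  ext u
  rw [formInChart_apply]
  refine form_apply_congr η ((extChartAt 𝓘(ℝ, E) x').left_inv hz').symm ?_
  ext i
  have h := mfderivWithin_extChartAt_symm_comp_mfderiv_extChartAt' (I := 𝓘(ℝ, E)) hz'
  have h2 := congrArg (fun L : E →L[ℝ] E ↦ L (chartFrame E x₀ z (u i))) h
  have h3 := chartFrame_eq_mfderivWithin (E := E) x'
    (extChartAt 𝓘(ℝ, E) x' ((extChartAt 𝓘(ℝ, E) x₀).symm z))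
  have h4 := congrArg (fun L : E →L[ℝ] E ↦ L (mfderiv 𝓘(ℝ, E) 𝓘(ℝ, E) (extChartAt 𝓘(ℝ, E) x')
    ((extChartAt 𝓘(ℝ, E) x₀).symm z) (chartFrame E x₀ z (u i)))) h3
  refine (h4.trans h2).symm.trans ?_
  exact (congrArg (chartFrame E x' _) (fderiv_transition hz hz' (u i))).symm

theorem contDiffAt_transition {z : E} (hz : z ∈ (extChartAt 𝓘(ℝ, E) x₀).target)
    (hz' : (extChartAt 𝓘(ℝ, E) x₀).symm z ∈ (extChartAt 𝓘(ℝ, E) x').source) :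
    ContDiffAt ℝ ∞ (extChartAt 𝓘(ℝ, E) x' ∘ (extChartAt 𝓘(ℝ, E) x₀).symm) z := by
  rw [extChartAt_source] at hz'
  rw [← contMDiffAt_iff_contDiffAt]
  refine (contMDiffAt_extChartAt' hz').comp z ?_
  exact (contMDiffOn_extChartAt_symm x₀).contMDiffAt ((isOpen_extChartAt_target x₀).mem_nhds hz)

/-- `extDer` uses a different chart at every point. Naturality of the exterior derivative under
transition maps shows that one fixed chart computes it everywhere on its domain, which gives
smoothness of `extDer η` and d² = 0. -/
theorem formInChart_extDer {n : ℕ} {η : DForm E M n} (hη : IsSmoothForm η) {z : E}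
    (hz : z ∈ (extChartAt 𝓘(ℝ, E) x₀).target) :
    formInChart (extDer η) x₀ z = extDeriv (formInChart η x₀) z := by
  set q := (extChartAt 𝓘(ℝ, E) x₀).symm z with hq
  have hqs := mem_extChartAt_source (I := 𝓘(ℝ, E)) q
  have hev : formInChart η x₀ =ᶠ[𝓝 z] fun z ↦ (formInChart η q
      ((extChartAt 𝓘(ℝ, E) q ∘ (extChartAt 𝓘(ℝ, E) x₀).symm) z)).compContinuousLinearMap
        (fderiv ℝ (extChartAt 𝓘(ℝ, E) q ∘ (extChartAt 𝓘(ℝ, E) x₀).symm) z) := by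
    have hc : ContinuousAt (extChartAt 𝓘(ℝ, E) x₀).symm z :=
      continuousAt_extChartAt_symm'' hz
    filter_upwards [(isOpen_extChartAt_target x₀).mem_nhds hz,
      hc.eventually (extChartAt_source_mem_nhds (I := 𝓘(ℝ, E)) q)] with w hw hw'
    exact formInChart_transition η hw hw'
  have hd : DifferentiableAt ℝ (formInChart η q)
      ((extChartAt 𝓘(ℝ, E) q ∘ (extChartAt 𝓘(ℝ, E) x₀).symm) z) :=
    differentiableAt_of_smooth (hη.contDiffAt (mem_extChartAt_target q))
  rw [hev.extDeriv_eq, extDeriv_pullback hd (contDiffAt_transition hz hqs)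
    minSmoothness_two_le]
  ext u
  refine congrArg (extDeriv (formInChart η q) (extChartAt 𝓘(ℝ, E) q q)) ?_
  ext i
  exact (fderiv_transition hz hqs (u i)).symm

end Transition

theorem IsSmoothForm.extDer {n : ℕ} {η : DForm E M n} (hη : IsSmoothForm η) :
    IsSmoothForm (extDer η) := by
  intro x₀ z hz
  refine ContDiffAt.contDiffWithinAt ?_
  have hev : formInChart (CharPair.extDer η) x₀ =ᶠ[𝓝 z] extDeriv (formInChart η x₀) := by
    filter_upwards [(isOpen_extChartAt_target x₀).mem_nhds hz] with w hw
    exact formInChart_extDer hη hw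
  refine ContDiffAt.congr_of_eventuallyEq ?_ hev
  have h := (hη.contDiffAt hz).fderiv_right (m := ∞) (by simp)
  exact (ContinuousAlternatingMap.alternatizeUncurryFinCLM ℝ E ℝ).contDiff.contDiffAt.comp z h

theorem IsSmoothForm.isClosedForm_extDer {n : ℕ} {η : DForm E M n} (hη : IsSmoothForm η) :
    IsClosedForm (CharPair.extDer η) := by
  intro x
  refine (extDer_eq_extDeriv (CharPair.extDer η) x).trans ?_
  have hev : formInChart (CharPair.extDer η) x =ᶠ[𝓝 (extChartAt 𝓘(ℝ, E) x x)]
      extDeriv (formInChart η x) := by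
    filter_upwards [eventually_mem_extChartAt_target x] with w hw
    exact formInChart_extDer hη hw
  rw [hev.extDeriv_eq]
  exact extDeriv_extDeriv_apply (hη.contDiffAt (mem_extChartAt_target x)) minSmoothness_two_le

end Naturality

/-! ### Forms of degree one and two as linear and bilinear forms -/

section ToBilin

variable {V : Type*} [AddCommGroup V] [Module ℝ V] [TopologicalSpace V]

theorem alternating_two_add_left (η : V [⋀^Fin 2]→L[ℝ] ℝ) (u u' v : V) :
    η ![u + u', v] = η ![u, v] + η ![u', v] := by
  simpa using η.toMultilinearMap.cons_add ![v] u u'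

theorem alternating_two_smul_left (η : V [⋀^Fin 2]→L[ℝ] ℝ) (c : ℝ) (u v : V) :
    η ![c • u, v] = c * η ![u, v] := by
  simpa using η.toMultilinearMap.cons_smul ![v] c u

theorem alternating_two_swap (η : V [⋀^Fin 2]→L[ℝ] ℝ) (u v : V) : η ![v, u] = -η ![u, v] := by
  have h := η.toAlternatingMap.map_swap ![u, v] (i := 0) (j := 1) (by decide)
  refine Eq.trans (congrArg η ?_) h
  ext i
  fin_cases i <;> rfl

variable [IsTopologicalAddGroup V] [ContinuousSMul ℝ V] [T2Space V] [FiniteDimensional ℝ V]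

/-- A `2`-form as a bilinear form. -/
def twoFormBilin (η : V [⋀^Fin 2]→L[ℝ] ℝ) : V →L[ℝ] V →L[ℝ] ℝ :=
  LinearMap.toContinuousLinearMap (LinearMap.toContinuousLinearMap.toLinearMap ∘ₗ
    LinearMap.mk₂ ℝ (fun u v ↦ η ![u, v]) (alternating_two_add_left η)
      (alternating_two_smul_left η)
      (fun u v v' ↦ by
        rw [alternating_two_swap η v, alternating_two_swap η v', alternating_two_swap η (v + v'),
          alternating_two_add_left, neg_add])
      (fun c u v ↦ by
        rw [alternating_two_swap η v, alternating_two_swap η (c • v), alternating_two_smul_left,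
          smul_eq_mul, mul_neg]))

/-- A `1`-form as a linear form. -/
def oneFormLin (α : V [⋀^Fin 1]→L[ℝ] ℝ) : V →L[ℝ] ℝ :=
  LinearMap.toContinuousLinearMap
    { toFun := fun u ↦ α ![u]
      map_add' := fun u v ↦ by simpa using α.toMultilinearMap.cons_add ![] u v
      map_smul' := fun c u ↦ by simpa using α.toMultilinearMap.cons_smul ![] c u }

end ToBilin

/-! ### Coordinate formulas for exterior derivatives -/

section Calculus

variable {E : Type*} [NormedAddCommGroup E] [NormedSpace ℝ E]

theorem fderiv_bilin_eq {b : E → E →L[ℝ] E →L[ℝ] ℝ} {y : E} (hb : DifferentiableAt ℝ b y)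
    {f : E → ℝ} {u v : E} (hf : (fun z ↦ b z u v) =ᶠ[𝓝 y] f) (a : E) :
    fderiv ℝ b y a u v = fderiv ℝ f y a := by
  rw [← hf.fderiv_eq, fderiv_bilin_apply hb (differentiableAt_const u) (differentiableAt_const v)]
  simp

theorem fderiv_alternating_apply {n : ℕ} {θ : E → E [⋀^Fin n]→L[ℝ] ℝ} {y : E}
    (hω : DifferentiableAt ℝ θ y) (v : Fin n → E) (a : E) :
    fderiv ℝ (fun z ↦ θ z v) y a = fderiv ℝ θ y a v := by
  have h := (ContinuousAlternatingMap.apply ℝ E ℝ v).hasFDerivAt.comp y hω.hasFDerivAt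
  rw [HasFDerivAt.fderiv (f := fun z ↦ θ z v) h]
  rfl

theorem fderiv_add_mul_form_apply {θ : E → E [⋀^Fin 2]→L[ℝ] ℝ} {a : E → E [⋀^Fin 1]→L[ℝ] ℝ}
    {y : E} (hθ : DifferentiableAt ℝ θ y) (ha : DifferentiableAt ℝ a y) (u v c : E) :
    fderiv ℝ (fun z ↦ θ z ![u, v] + a z ![u] * a z ![v]) y c = fderiv ℝ θ y c ![u, v] +
      (a y ![u] * fderiv ℝ a y c ![v] + a y ![v] * fderiv ℝ a y c ![u]) := by
  have d1 (u : E) : DifferentiableAt ℝ (fun z ↦ a z ![u]) y :=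
    (ContinuousAlternatingMap.apply ℝ E ℝ ![u]).differentiableAt.comp y ha
  have d2 : DifferentiableAt ℝ (fun z ↦ θ z ![u, v]) y :=
    (ContinuousAlternatingMap.apply ℝ E ℝ ![u, v]).differentiableAt.comp y hθ
  have d3 := (d1 u).fun_mul (d1 v)
  rw [fderiv_fun_add d2 d3, fderiv_fun_mul (d1 u) (d1 v)]
  simp only [_root_.add_apply, _root_.smul_apply, smul_eq_mul]
  rw [fderiv_alternating_apply hθ, fderiv_alternating_apply ha, fderiv_alternating_apply ha]

/-- This is dθ(n, u, v) = 0 written out: the invariance identity of `IsTransverseForm`, valid here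
for every n. -/
theorem fderiv_two_form_of_closed {θ : E → E [⋀^Fin 2]→L[ℝ] ℝ} {y : E}
    (hω : DifferentiableAt ℝ θ y) (hd : extDeriv θ y = 0) (n u v : E) :
    fderiv ℝ θ y n ![u, v] = fderiv ℝ θ y u ![n, v] + fderiv ℝ θ y v ![u, n] := by
  have h := extDeriv_apply hω ![n, u, v]
  have e0 : (0 : Fin 3).removeNth ![n, u, v] = ![u, v] := by
    ext i; fin_cases i <;> rfl
  have e1 : (1 : Fin 3).removeNth ![n, u, v] = ![n, v] := by
    ext i; fin_cases i <;> rfl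
  have e2 : (2 : Fin 3).removeNth ![n, u, v] = ![n, u] := by
    ext i; fin_cases i <;> rfl
  rw [hd, Fin.sum_univ_three, e0, e1, e2] at h
  simp only [fderiv_alternating_apply hω] at h
  have hs := alternating_two_swap (fderiv ℝ θ y v) n u
  simp at h
  linarith

theorem fderiv_one_form_of_extDeriv {a : E → E [⋀^Fin 1]→L[ℝ] ℝ} {y : E}
    (ha : DifferentiableAt ℝ a y) (u v : E) :
    extDeriv a y ![u, v] = fderiv ℝ a y u ![v] - fderiv ℝ a y v ![u] := by
  have h := extDeriv_apply ha ![u, v]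
  have e0 : (0 : Fin 2).removeNth ![u, v] = ![v] := by
    ext i; fin_cases i; rfl
  have e1 : (1 : Fin 2).removeNth ![u, v] = ![u] := by
    ext i; fin_cases i; rfl
  rw [Fin.sum_univ_two, e0, e1] at h
  simp only [fderiv_alternating_apply ha] at h
  rw [h]
  simp
  ring

end Calculus

/-! ### Transverse forms from closed 2-forms and contact forms -/

section Forms

universe u v

variable {E : Type u} [NormedAddCommGroup E] [NormedSpace ℝ E] [FiniteDimensional ℝ E]
  {M : Type v} [TopologicalSpace M] [ChartedSpace E M] [IsManifold 𝓘(ℝ, E) ∞ M]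

/-- A field of `2`-forms as a field of bilinear forms. -/
def twoFormField (η : DForm E M 2) : BField E M := fun x ↦ twoFormBilin (η x)

/-- The field of bilinear forms `dα + α ⊗ α`. -/
def contactField (α : DForm E M 1) : BField E M := fun x ↦
  twoFormBilin (extDer α x) + (oneFormLin (α x)).smulRight (oneFormLin (α x))

theorem bilInChart_twoFormField (η : DForm E M 2) (x₀ : M) (y u v : E) :
    bilInChart (twoFormField η) x₀ y u v = formInChart η x₀ y ![u, v] := by
  rw [formInChart_apply]
  refine congrArg (η _) ?_
  ext i
  fin_cases i <;> rfl

theorem bilInChart_contactField (α : DForm E M 1) (x₀ : M) (y u v : E) :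
    bilInChart (contactField α) x₀ y u v = formInChart (extDer α) x₀ y ![u, v] +
      formInChart α x₀ y ![u] * formInChart α x₀ y ![v] := by
  have h1 (u : E) : formInChart α x₀ y ![u] = α _ ![chartFrame E x₀ y u] := by
    rw [formInChart_apply]
    refine congrArg (α _) ?_
    ext i
    fin_cases i
    rfl
  rw [← bilInChart_twoFormField, h1, h1]
  rfl

theorem contDiffAt_form_apply {n : ℕ} {θ : E → E [⋀^Fin n]→L[ℝ] ℝ} {y : E}
    (h : ContDiffAt ℝ ∞ θ y) (v : Fin n → E) : ContDiffAt ℝ ∞ (fun z ↦ θ z v) y :=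
  (ContinuousAlternatingMap.apply ℝ E ℝ v).contDiff.contDiffAt.comp y h

theorem isTransverseForm_twoFormField {η : DForm E M 2} (hη : IsSmoothForm η)
    (hc : IsClosedForm η) {D : Distribution E M}
    (hD : ∀ x v, v ∈ D x ↔ ∀ w, η x ![v, w] = 0) : IsTransverseForm (twoFormField η) D := by
  have hs (x : M) : ContDiffAt ℝ ∞ (bilInChart (twoFormField η) x) (extChartAt 𝓘(ℝ, E) x x) := by
    refine contDiffAt_bilin_of_apply fun u v ↦ ?_
    simp only [bilInChart_twoFormField]
    exact contDiffAt_form_apply (hη.contDiffAt (mem_extChartAt_target x)) _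
  refine ⟨hs, hD, fun x v hv w ↦ ?_, fun x N hN u v ↦ ?_⟩
  · refine (alternating_two_swap (η x) v w).trans ?_
    rw [(hD x v).1 hv w, neg_zero]
  · have hω := differentiableAt_of_smooth (hη.contDiffAt (mem_extChartAt_target x))
    have hb := differentiableAt_of_smooth (hs x)
    have key (a u v : E) : fderiv ℝ (bilInChart (twoFormField η) x) (extChartAt 𝓘(ℝ, E) x x) a u v
        = fderiv ℝ (formInChart η x) (extChartAt 𝓘(ℝ, E) x x) a ![u, v] := by
      rw [fderiv_bilin_eq hb (.of_forall fun z ↦ bilInChart_twoFormField η x z u v),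
        fderiv_alternating_apply hω]
    rw [key, key, key]
    exact fderiv_two_form_of_closed hω ((extDer_eq_extDeriv η x).symm.trans (hc x)) N u v

/-- For N in D, Cartan's formula gives L_N α = ι_N dα + d(α(N)) = 0, so both dα and α ⊗ α are
invariant. The symmetric term detects α and the skew term detects dα, so the kernel is their common
kernel. -/
theorem isTransverseForm_contactField {α : DForm E M 1} (hα : IsSmoothForm α)
    {D : Distribution E M}
    (hD : ∀ x v, v ∈ D x ↔ α x ![v] = 0 ∧ ∀ w, extDer α x ![v, w] = 0) :
    IsTransverseForm (contactField α) D := by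
  have hω := hα.extDer
  have happ (x : M) (v w : TangentSpace 𝓘(ℝ, E) x) :
      contactField α x v w = extDer α x ![v, w] + α x ![v] * α x ![w] := rfl
  have hs (x : M) : ContDiffAt ℝ ∞ (bilInChart (contactField α) x) (extChartAt 𝓘(ℝ, E) x x) := by
    refine contDiffAt_bilin_of_apply fun u v ↦ ?_
    simp only [bilInChart_contactField]
    exact (contDiffAt_form_apply (hω.contDiffAt (mem_extChartAt_target x)) _).add
      ((contDiffAt_form_apply (hα.contDiffAt (mem_extChartAt_target x)) _).mul
        (contDiffAt_form_apply (hα.contDiffAt (mem_extChartAt_target x)) _))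
  refine ⟨hs, fun x v ↦ ?_, fun x v hv w ↦ ?_, fun x N hN u v ↦ ?_⟩
  · rw [hD]
    refine ⟨fun ⟨h1, h2⟩ w ↦ by rw [happ, h1, h2, zero_mul, zero_add], fun h ↦ ?_⟩
    -- On the pair (v, v) the skew part vanishes and α(v)² remains.
    have h1 : α x ![v] = 0 := by
      have e := h v
      have e2 := alternating_two_swap (extDer α x) v v
      rw [happ] at e
      have : extDer α x ![v, v] = 0 := by linarith
      rw [this, zero_add] at e
      exact mul_self_eq_zero.1 e
    refine ⟨h1, fun w ↦ ?_⟩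
    have e := h w
    rwa [happ, h1, zero_mul, add_zero] at e
  · obtain ⟨h1, h2⟩ := (hD x v).1 hv
    rw [happ, h1, mul_zero, add_zero, alternating_two_swap, h2, neg_zero]
  · obtain ⟨h1, h2⟩ := (hD x N).1 hN
    set y := extChartAt 𝓘(ℝ, E) x x with hy
    have hωd := differentiableAt_of_smooth (hω.contDiffAt (mem_extChartAt_target x))
    have hαd := differentiableAt_of_smooth (hα.contDiffAt (mem_extChartAt_target x))
    have hb := differentiableAt_of_smooth (hs x)
    set a := formInChart α x with ha
    have key (c u v : E) : fderiv ℝ (bilInChart (contactField α) x) y c u v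
        = fderiv ℝ (formInChart (extDer α) x) y c ![u, v] +
          (a y ![u] * fderiv ℝ a y c ![v] + a y ![v] * fderiv ℝ a y c ![u]) := by
      rw [fderiv_bilin_eq hb (.of_forall fun z ↦ bilInChart_contactField α x z u v)]
      exact fderiv_add_mul_form_apply hωd hαd u v c
    have hclosed := fderiv_two_form_of_closed hωd
      ((extDer_eq_extDeriv (extDer α) x).symm.trans (hα.isClosedForm_extDer x)) N u v
    have haN : a y ![N] = 0 := by
      refine Eq.trans ?_ h1
      rw [ha, formInChart_apply]
      refine form_apply_congr α (extChartAt_to_inv x) ?_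
      ext i
      fin_cases i
      exact chartFrame_self x N
    -- This is L_N α = 0 in pointwise form: dα(N, w) = 0 makes the two partial derivatives agree.
    have hd (w : E) : fderiv ℝ a y N ![w] = fderiv ℝ a y w ![N] := by
      have e := fderiv_one_form_of_extDeriv hαd N w
      have e2 : extDeriv a y ![N, w] = 0 :=
        (congrArg (fun L : E [⋀^Fin 2]→L[ℝ] ℝ ↦ L ![N, w]) (extDer_eq_extDeriv α x)).symm.trans
          (h2 w)
      rw [e2] at e
      linarith
    rw [key, key, key, hclosed, haN, hd, hd]
    ring

end Forms

/-! ### Powers of a 2-form and symplectic families -/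

section Wedge

open Equiv

variable {V : Type*} [AddCommGroup V] [Module ℝ V]

theorem factorial_mul_wedge_apply {m n : ℕ} (a : V [⋀^Fin m]→ₗ[ℝ] ℝ) (b : V [⋀^Fin n]→ₗ[ℝ] ℝ)
    (z : Fin m ⊕ Fin n → V) :
    (m.factorial * n.factorial : ℝ) * wedge a b (z ∘ finSumFinEquiv.symm) =
      ∑ σ : Perm (Fin m ⊕ Fin n), ((Perm.sign σ : ℤ) : ℝ) *
        (a (z ∘ σ ∘ Sum.inl) * b (z ∘ σ ∘ Sum.inr)) := by
  have h := congrArg (fun f ↦ LinearMap.mul' ℝ ℝ (f z))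
    (MultilinearMap.domCoprod_alternization_eq a b)
  simp only [MultilinearMap.alternatization_apply, map_sum, Fintype.card_fin] at h
  have h' := h.trans (map_nsmul (LinearMap.mul' ℝ ℝ) (m.factorial * n.factorial)
    (a.domCoprod b z))
  have e : wedge a b (z ∘ finSumFinEquiv.symm) = LinearMap.mul' ℝ ℝ (a.domCoprod b z) := by
    rw [wedge, AlternatingMap.domDomCongr_apply, LinearMap.compAlternatingMap_apply]
    congr 2
    ext i
    simp
  rw [e, ← Nat.cast_mul, ← nsmul_eq_mul, ← h']
  refine Finset.sum_congr rfl fun σ _ ↦ ?_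
  rw [Units.smul_def, map_zsmul, zsmul_eq_mul]
  rfl

theorem wedge_eq_zero_of_forall {m n : ℕ} (a : V [⋀^Fin m]→ₗ[ℝ] ℝ) (b : V [⋀^Fin n]→ₗ[ℝ] ℝ)
    (w : Fin (m + n) → V) (h : ∀ σ : Perm (Fin m ⊕ Fin n),
      a (w ∘ finSumFinEquiv ∘ σ ∘ Sum.inl) = 0 ∨ b (w ∘ finSumFinEquiv ∘ σ ∘ Sum.inr) = 0) :
    wedge a b w = 0 := by
  have e := factorial_mul_wedge_apply a b (w ∘ finSumFinEquiv)
  rw [Finset.sum_eq_zero fun σ _ ↦ ?_] at e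
  · have hw : (w ∘ finSumFinEquiv) ∘ finSumFinEquiv.symm = w := by
      ext i
      simp
    rw [hw] at e
    refine (mul_eq_zero.1 e).resolve_left ?_
    positivity
  · rcases h σ with h | h
    · exact mul_eq_zero_of_right _ (mul_eq_zero_of_left h _)
    · exact mul_eq_zero_of_right _ (mul_eq_zero_of_right _ h)

theorem mem_formKer_iff {n : ℕ} {η : V [⋀^Fin n]→ₗ[ℝ] ℝ} {v : V} :
    v ∈ formKer η ↔ ∀ (w : Fin n → V) (i : Fin n), w i = v → η w = 0 := by
  rw [mem_formKer]
  refine ⟨fun h w i hw ↦ ?_, fun h w i ↦ h _ i (Function.update_self i v w)⟩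
  have := h w i
  rwa [← hw, Function.update_eq_self] at this

/-- In every term of the antisymmetrized product the vector v is inserted into one of the two
factors. -/
theorem inf_formKer_le_formKer_wedge {m n : ℕ} (a : V [⋀^Fin m]→ₗ[ℝ] ℝ) (b : V [⋀^Fin n]→ₗ[ℝ] ℝ) :
    formKer a ⊓ formKer b ≤ formKer (wedge a b) := by
  rintro v ⟨ha, hb⟩
  have ha := mem_formKer_iff.1 ha
  have hb := mem_formKer_iff.1 hb
  refine mem_formKer_iff.2 fun w i hi ↦ wedge_eq_zero_of_forall a b w fun σ ↦ ?_
  rcases hj : σ.symm (finSumFinEquiv.symm i) with j | j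
  · refine Or.inl (ha _ j ?_)
    simp [← hj, hi]
  · refine Or.inr (hb _ j ?_)
    simp [← hj, hi]

theorem formKer_le_formKer_wedgePow (η : V [⋀^Fin 2]→ₗ[ℝ] ℝ) (k : ℕ) :
    formKer η ≤ formKer (wedgePow η k) := by
  induction k with
  | zero => exact fun v _ ↦ mem_formKer.2 fun w i ↦ i.elim0
  | succ k ih => exact (le_inf ih le_rfl).trans (inf_formKer_le_formKer_wedge _ _)

/-- Up to a positive factor, `φ` is the antisymmetrization of `F`. -/
def IsSkewSum {α : Type*} [Fintype α] [DecidableEq α] (φ F : (α → V) → ℝ) : Prop :=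
  ∃ c : ℝ, 0 < c ∧ ∀ z, c * φ z = ∑ σ : Perm α, ((Perm.sign σ : ℤ) : ℝ) * F (z ∘ σ)

theorem IsSkewSum.reindex {α β : Type*} [Fintype α] [DecidableEq α] [Fintype β] [DecidableEq β]
    {φ F : (α → V) → ℝ} (h : IsSkewSum φ F) (e : α ≃ β) :
    IsSkewSum (fun z : β → V ↦ φ (z ∘ e)) (fun z : β → V ↦ F (z ∘ e)) := by
  obtain ⟨c, hc, h⟩ := h
  refine ⟨c, hc, fun z ↦ ?_⟩
  rw [h, ← Equiv.sum_comp e.permCongr]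
  refine Finset.sum_congr rfl fun σ _ ↦ ?_
  rw [Perm.sign_permCongr]
  congr 2
  ext i
  simp [Equiv.permCongr_apply]

/-- Antisymmetrizing a partial antisymmetrization changes nothing but the constant: each inner
permutation τ is absorbed by the substitution σ ↦ σ (τ ⊕ 1). -/
theorem IsSkewSum.wedge {m n : ℕ} {a : V [⋀^Fin m]→ₗ[ℝ] ℝ} {F : (Fin m → V) → ℝ}
    (h : IsSkewSum a F) (b : V [⋀^Fin n]→ₗ[ℝ] ℝ) :
    IsSkewSum (fun z : Fin m ⊕ Fin n → V ↦ wedge a b (z ∘ finSumFinEquiv.symm))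
      (fun z ↦ F (z ∘ Sum.inl) * b (z ∘ Sum.inr)) := by
  obtain ⟨c, hc, h⟩ := h
  set N : ℝ := (Fintype.card (Perm (Fin m)) : ℝ) with hN
  have hN0 : 0 < N := by
    rw [hN, Nat.cast_pos]
    exact Fintype.card_pos
  refine ⟨c * (m.factorial * n.factorial) / N, by positivity, fun z ↦ ?_⟩
  set G : Perm (Fin m ⊕ Fin n) → ℝ := fun σ ↦ ((Perm.sign σ : ℤ) : ℝ) *
    (F ((z ∘ σ) ∘ Sum.inl) * b ((z ∘ σ) ∘ Sum.inr)) with hG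
  have key : c * (m.factorial * n.factorial * CharPair.wedge a b (z ∘ finSumFinEquiv.symm)) =
      ∑ τ : Perm (Fin m), ∑ σ : Perm (Fin m ⊕ Fin n), G (σ * Perm.sumCongr τ 1) := by
    rw [factorial_mul_wedge_apply, Finset.mul_sum, Finset.sum_comm]
    refine Finset.sum_congr rfl fun σ _ ↦ ?_
    have := h (z ∘ σ ∘ Sum.inl)
    rw [mul_left_comm, ← mul_assoc c, this, Finset.sum_mul, Finset.mul_sum]
    refine Finset.sum_congr rfl fun τ _ ↦ ?_
    simp only [hG, Perm.sign_mul, Perm.sign_sumCongr, map_one, mul_one, Units.val_mul,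
      Int.cast_mul, Perm.coe_mul]
    have e1 : ((z ∘ σ ∘ Perm.sumCongr τ 1) ∘ Sum.inl : Fin m → V) = (z ∘ σ ∘ Sum.inl) ∘ τ := by
      ext i
      simp
    have e2 : ((z ∘ σ ∘ Perm.sumCongr τ 1) ∘ Sum.inr : Fin n → V) = z ∘ σ ∘ Sum.inr := by
      ext i
      simp
    rw [e1, e2]
    ring
  have key2 (τ : Perm (Fin m)) : ∑ σ : Perm (Fin m ⊕ Fin n), G (σ * Perm.sumCongr τ 1) =
      ∑ σ, G σ := Equiv.sum_comp (Equiv.mulRight (Perm.sumCongr τ 1)) G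
  simp only [key2, Finset.sum_const, Finset.card_univ, nsmul_eq_mul] at key
  change _ = ∑ σ, G σ
  rw [div_mul_eq_mul_div, div_eq_iff hN0.ne', mul_comm _ N, ← key]
  ring

/-- Indexing the arguments by pairs makes the product of values of η visible. Only nonvanishing of
the power matters later, so a positive constant may stay implicit. -/
theorem exists_isSkewSum_wedgePow (η : V [⋀^Fin 2]→ₗ[ℝ] ℝ) (k : ℕ) :
    ∃ (ι : Type) (_ : Fintype ι) (_ : DecidableEq ι) (e : Fin (2 * k) ≃ ι × Fin 2),
      IsSkewSum (fun z : ι × Fin 2 → V ↦ wedgePow η k (z ∘ e))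
        (fun z ↦ ∏ i, η ![z (i, 0), z (i, 1)]) := by
  induction k with
  | zero =>
    refine ⟨Fin 0, inferInstance, inferInstance, Equiv.equivOfIsEmpty (Fin 0) _, 1, one_pos,
      fun z ↦ ?_⟩
    simp [wedgePow]
  | succ k ih =>
    obtain ⟨ι, _, _, e, h⟩ := ih
    have h1 := h.reindex e.symm
    have h2 : IsSkewSum (wedgePow η k)
        (fun z ↦ ∏ i, η ![z (e.symm (i, 0)), z (e.symm (i, 1))]) := by
      have hz (z : Fin (2 * k) → V) : (z ∘ e.symm) ∘ e = z := by
        ext i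
        simp
      simp only [hz] at h1
      exact h1
    set E : Fin (2 * k) ⊕ Fin 2 ≃ (ι ⊕ Unit) × Fin 2 :=
      (Equiv.sumCongr e (Equiv.punitProd (Fin 2)).symm).trans
        (Equiv.sumProdDistrib ι Unit (Fin 2)).symm with hE
    refine ⟨ι ⊕ Unit, inferInstance, inferInstance, finSumFinEquiv.symm.trans E, ?_⟩
    convert (h2.wedge η).reindex E using 1
    · rfl
    ext z
    rw [Fintype.prod_sum_type, Fintype.prod_unique (ι := Unit)]
    congr 1
    · refine Finset.prod_congr rfl fun i _ ↦ ?_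
      simp [hE]
    · refine congrArg η ?_
      ext i
      fin_cases i <;> rfl

section Hyperbolic

variable {ι : Type*} [Fintype ι] [DecidableEq ι]

/-- The standard symplectic form, on the basis vectors. -/
def standardSymplectic (x y : ι × Fin 2) : ℝ :=
  if x.1 = y.1 then ((y.2 : ℕ) : ℝ) - ((x.2 : ℕ) : ℝ) else 0

/-- A nonzero term requires σ to carry pairs to pairs: σ is a permutation T of the pairs after flips
inside them. T acts on two copies of ι and has sign 1, while each flip contributes -1 both to the
sign and to the product. -/
theorem sign_mul_prod_standardSymplectic_nonneg (σ : Perm (ι × Fin 2)) :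
    0 ≤ ((Perm.sign σ : ℤ) : ℝ) * ∏ i, standardSymplectic (σ (i, 0)) (σ (i, 1)) := by
  by_cases hall : ∀ i, (σ (i, 0)).1 = (σ (i, 1)).1
  swap
  · obtain ⟨i, hi⟩ := not_forall.1 hall
    rw [Finset.prod_eq_zero (Finset.mem_univ i) (if_neg hi), mul_zero]
  set ρ : ι → Perm (Fin 2) := fun i ↦ Equiv.swap 0 (σ (i, 0)).2 with hρ
  have hσ (i : ι) (a : Fin 2) : σ (i, a) = ((σ (i, 0)).1, ρ i a) := by
    have hne : (σ (i, 0)).2 ≠ (σ (i, 1)).2 := fun h ↦ by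
      have := σ.injective (Prod.ext (hall i) h)
      simp at this
    have h2 : ∀ p q : Fin 2, p ≠ q → Equiv.swap 0 p 1 = q := by decide
    fin_cases a
    · simp [hρ]
    · exact Prod.ext (hall i).symm (h2 _ _ hne).symm
  have hsurj : Function.Surjective fun i ↦ (σ (i, 0)).1 := by
    intro j
    refine ⟨(σ.symm (j, 0)).1, ?_⟩
    have := hσ (σ.symm (j, 0)).1 (σ.symm (j, 0)).2
    rw [Prod.mk.eta, σ.apply_symm_apply] at this
    exact (congrArg Prod.fst this).symm
  set T : Perm ι := Equiv.ofBijective _ ⟨Finite.injective_iff_surjective.2 hsurj, hsurj⟩ with hT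
  have hdec : σ = prodCongrLeft (fun _ : Fin 2 ↦ T) * prodCongrRight ρ := by
    ext ⟨i, a⟩ : 1
    rw [hσ]
    rfl
  have hsign : Perm.sign σ = ∏ i, Perm.sign (ρ i) := by
    rw [hdec, Perm.sign_mul, Perm.sign_prodCongrLeft, Perm.sign_prodCongrRight, Fin.prod_univ_two,
      Int.units_mul_self, one_mul]
  rw [hsign, Units.coe_prod, Int.cast_prod, ← Finset.prod_mul_distrib]
  refine Finset.prod_nonneg fun i _ ↦ ?_
  rw [hσ i 0, hσ i 1, standardSymplectic, if_pos rfl]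
  have key : ∀ p : Fin 2, 0 ≤ ((Perm.sign (Equiv.swap 0 p) : ℤ) : ℝ) *
      (((Equiv.swap 0 p 1 : Fin 2) : ℕ) - ((Equiv.swap 0 p 0 : Fin 2) : ℕ) : ℝ) := by
    intro p
    fin_cases p <;> simp
  exact key _

/-- Evaluated on a symplectic family, all terms of the antisymmetrization are nonnegative and the
identity contributes 1, so nothing can cancel. -/
theorem wedgePow_ne_zero_of_standardSymplectic {η : V [⋀^Fin 2]→ₗ[ℝ] ℝ} {k : ℕ}
    {h : Fin k × Fin 2 → V} (hh : ∀ x y, η ![h x, h y] = standardSymplectic x y) :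
    wedgePow η k ≠ 0 := by
  obtain ⟨ι, _, _, e, c, -, hc⟩ := exists_isSkewSum_wedgePow η k
  have hcard : Fintype.card ι = k := by
    have := Fintype.card_congr e
    simp only [Fintype.card_fin, Fintype.card_prod] at this
    omega
  let ε : ι ≃ Fin k := Fintype.equivFinOfCardEq hcard
  set z : ι × Fin 2 → V := fun x ↦ h (ε x.1, x.2) with hz
  have hηz (x y : ι × Fin 2) : η ![z x, z y] = standardSymplectic x y := by
    rw [hz, hh]
    simp [standardSymplectic]
  intro h0
  have hsum := hc z
  simp only [h0, Function.comp_apply, hηz, AlternatingMap.zero_apply, mul_zero] at hsum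
  have hpos : 0 < ∑ σ : Perm (ι × Fin 2), ((Perm.sign σ : ℤ) : ℝ) *
      ∏ i, standardSymplectic (σ (i, 0)) (σ (i, 1)) := by
    refine Finset.sum_pos' (fun σ _ ↦ sign_mul_prod_standardSymplectic_nonneg σ)
      ⟨1, Finset.mem_univ _, ?_⟩
    simp [standardSymplectic]
  exact hpos.ne hsum

end Hyperbolic

/-- A bilinear form of rank at least `2k - 1` has a symplectic family of `k` pairs. -/
theorem exists_standardSymplectic [FiniteDimensional ℝ V] {B : LinearMap.BilinForm ℝ V}
    (hB : ∀ v, B v v = 0) (k : ℕ)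
    (hk : Module.finrank ℝ (LinearMap.ker B) + 2 * k ≤ Module.finrank ℝ V + 1) :
    ∃ h : Fin k × Fin 2 → V, ∀ x y, B (h x) (h y) = standardSymplectic x y := by
  have hskew (u v : V) : B u v = -B v u := by
    have := hB (u + v)
    simp only [map_add, LinearMap.add_apply, hB] at this
    linarith
  induction k with
  | zero => exact ⟨fun x ↦ x.1.elim0, fun x ↦ x.1.elim0⟩
  | succ k ih =>
    obtain ⟨h, hh⟩ := ih (by omega)
    set S := Submodule.span ℝ (Set.range h)
    -- Every vector splits into a part in the span S of the pairs found so far and a part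
    -- B-orthogonal to S.
    have hdec (v : V) : ∃ s ∈ S, ∀ x, B (v - s) (h x) = 0 := by
      refine ⟨∑ i, (B v (h (i, 1)) • h (i, 0) - B v (h (i, 0)) • h (i, 1)),
        Submodule.sum_mem _ fun i _ ↦ Submodule.sub_mem _
          (Submodule.smul_mem _ _ (Submodule.subset_span ⟨_, rfl⟩))
          (Submodule.smul_mem _ _ (Submodule.subset_span ⟨_, rfl⟩)), fun ⟨j, a⟩ ↦ ?_⟩
      simp only [map_sub, map_sum, map_smul, LinearMap.sub_apply, LinearMap.sum_apply,
        LinearMap.smul_apply, hh, standardSymplectic, smul_eq_mul]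
      fin_cases a <;> simp
    have hS (v : V) (hv : ∀ x, B v (h x) = 0) {s : V} (hs : s ∈ S) : B v s = 0 := by
      have : S ≤ LinearMap.ker (B v) := by
        rw [Submodule.span_le]
        rintro _ ⟨x, rfl⟩
        exact hv x
      exact this hs
    have hex : ∃ u v, (∀ x, B u (h x) = 0) ∧ (∀ x, B v (h x) = 0) ∧ B u v ≠ 0 := by
      by_contra hcon
      push Not at hcon
      -- If B vanished on the orthogonal complement of S, this complement would lie in ker B, so V =
      -- S + ker B would have dimension at most 2k + dim ker B, contrary to `hk`.
      have htop : S ⊔ LinearMap.ker B = ⊤ := by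
        rw [eq_top_iff]
        intro v _
        obtain ⟨s, hs, hsv⟩ := hdec v
        refine Submodule.mem_sup.2 ⟨s, hs, v - s, ?_, add_sub_cancel _ _⟩
        rw [LinearMap.mem_ker]
        ext w
        obtain ⟨t, ht, htw⟩ := hdec w
        have h1 := hcon _ _ hsv htw
        rw [map_sub, hS _ hsv ht, sub_zero] at h1
        rw [h1, LinearMap.zero_apply]
      have h1 := Submodule.finrank_add_le_finrank_add_finrank S (LinearMap.ker B)
      have h2 := finrank_range_le_card (R := ℝ) h
      rw [htop, finrank_top] at h1
      simp only [Fintype.card_prod, Fintype.card_fin] at h2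
      change Module.finrank ℝ S ≤ _ at h2
      omega
    obtain ⟨u, v, hu, hv, huv⟩ := hex
    have hu' (x) : B (h x) u = 0 := by rw [hskew, hu, neg_zero]
    have hv' (x) : B (h x) v = 0 := by rw [hskew, hv, neg_zero]
    -- The new pair is u and v, with v scaled so that B takes the value 1.
    refine ⟨fun x ↦ Fin.lastCases (if x.2 = 0 then u else (B u v)⁻¹ • v) (fun i ↦ h (i, x.2)) x.1,
      fun ⟨i, a⟩ ⟨j, b⟩ ↦ ?_⟩
    induction i using Fin.lastCases with
    | last =>
      induction j using Fin.lastCases with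
      | last =>
        have hvu := hskew v u
        fin_cases a <;> fin_cases b <;> simp [standardSymplectic, hB, huv, hvu]
      | cast j =>
        have hne : Fin.last k ≠ j.castSucc := (Fin.castSucc_lt_last j).ne'
        fin_cases a <;> simp [standardSymplectic, hu, hv, hne]
    | cast i =>
      induction j using Fin.lastCases with
      | last =>
        fin_cases b <;> simp [standardSymplectic, hu', hv']
      | cast j =>
        simp [hh, standardSymplectic]

end Wedge

/-! ### The kernel of α ∧ (dα)^k -/

section Kernels

variable {V : Type*} [AddCommGroup V] [Module ℝ V] [TopologicalSpace V] [IsTopologicalAddGroup V]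
  [ContinuousSMul ℝ V] [T2Space V] [FiniteDimensional ℝ V]

theorem mem_formKer_two (η : V [⋀^Fin 2]→L[ℝ] ℝ) (v : V) :
    v ∈ formKer η.toAlternatingMap ↔ ∀ w, η ![v, w] = 0 := by
  rw [mem_formKer_iff]
  refine ⟨fun h w ↦ h ![v, w] 0 rfl, fun h w i hi ↦ ?_⟩
  have hw : w = ![w 0, w 1] := by
    ext i
    fin_cases i <;> rfl
  change η w = 0
  rw [hw]
  fin_cases i
  · change w 0 = v at hi
    rw [hi, h]
  · change w 1 = v at hi
    rw [hi, alternating_two_swap, h, neg_zero]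

theorem mem_formKer_one (a : V [⋀^Fin 1]→L[ℝ] ℝ) (v : V) :
    v ∈ formKer a.toAlternatingMap ↔ a ![v] = 0 := by
  rw [mem_formKer_iff]
  refine ⟨fun h ↦ h ![v] 0 rfl, fun h w i hi ↦ ?_⟩
  have hw : w = ![v] := by
    ext j
    rw [Subsingleton.elim j i, hi]
    simp
  rw [hw]
  exact h

theorem finrank_le_finrank_formKer_one (a : V [⋀^Fin 1]→L[ℝ] ℝ) :
    Module.finrank ℝ V ≤ Module.finrank ℝ (formKer a.toAlternatingMap) + 1 := by
  have h : formKer a.toAlternatingMap = LinearMap.ker (oneFormLin a).toLinearMap := by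
    ext v
    exact mem_formKer_one a v
  have h1 := (oneFormLin a).toLinearMap.finrank_range_add_finrank_ker
  have h2 := Submodule.finrank_le (LinearMap.range (oneFormLin a).toLinearMap)
  rw [Module.finrank_self] at h2
  rw [h]
  omega

/-- A rank of at least 2k + 1 already provides k + 1 symplectic pairs, on which the (k+1)-st power
does not vanish. -/
theorem finrank_le_finrank_formKer_two {η : V [⋀^Fin 2]→L[ℝ] ℝ} {k : ℕ}
    (hη : wedgePow η.toAlternatingMap (k + 1) = 0) :
    Module.finrank ℝ V ≤ Module.finrank ℝ (formKer η.toAlternatingMap) + 2 * k := by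
  by_contra! hlt
  have h : formKer η.toAlternatingMap = LinearMap.ker (twoFormBilin η).toBilinForm := by
    ext v
    rw [mem_formKer_two, LinearMap.mem_ker, LinearMap.ext_iff]
    rfl
  obtain ⟨z, hz⟩ := exists_standardSymplectic (B := (twoFormBilin η).toBilinForm) (fun v ↦ by
    have := alternating_two_swap η v v
    change η ![v, v] = 0
    linarith) (k + 1) (by rw [← h]; omega)
  exact wedgePow_ne_zero_of_standardSymplectic (η := η.toAlternatingMap) hz hη

/-- The intersection lies in the left side and has codimension at most 1 + 2k, which is the
codimension of the left side by `hrank`. -/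
theorem formKer_contact_eq {a : V [⋀^Fin 1]→L[ℝ] ℝ} {η : V [⋀^Fin 2]→L[ℝ] ℝ} {k : ℕ}
    (hη : wedgePow η.toAlternatingMap (k + 1) = 0)
    (hrank : Module.finrank ℝ (formKer (wedge a.toAlternatingMap (wedgePow η.toAlternatingMap k))) +
      (2 * k + 1) = Module.finrank ℝ V) :
    formKer (wedge a.toAlternatingMap (wedgePow η.toAlternatingMap k)) =
      formKer a.toAlternatingMap ⊓ formKer η.toAlternatingMap := by
  refine (Submodule.eq_of_le_of_finrank_le ?_ ?_).symm
  · exact (inf_le_inf_left _ (formKer_le_formKer_wedgePow _ k)).trans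
      (inf_formKer_le_formKer_wedge _ _)
  · have h1 := finrank_le_finrank_formKer_one a
    have h2 := finrank_le_finrank_formKer_two hη
    have h3 := Submodule.finrank_sup_add_finrank_inf_eq (formKer a.toAlternatingMap)
      (formKer η.toAlternatingMap)
    have h4 := Submodule.finrank_le (formKer a.toAlternatingMap ⊔ formKer η.toAlternatingMap)
    omega

end Kernels

/-! ### The three kinds of pairs -/

section Pairs

universe u v

variable {E : Type u} [NormedAddCommGroup E] [NormedSpace ℝ E] [FiniteDimensional ℝ E]
  {M : Type v} [TopologicalSpace M] [ChartedSpace E M] [IsManifold 𝓘(ℝ, E) ∞ M]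

theorem finrank_tangentSpace (x : M) :
    Module.finrank ℝ (TangentSpace 𝓘(ℝ, E) x) = Module.finrank ℝ E := rfl

theorem isTransverseForm_kerTwo {η : DForm E M 2} (hη : IsSmoothForm η) (hc : IsClosedForm η) :
    IsTransverseForm (twoFormField η) (kerTwo η) :=
  isTransverseForm_twoFormField hη hc fun x v ↦ mem_formKer_two (η x) v

theorem isTransverseForm_kerContact {α : DForm E M 1} {k : ℕ} (hα : IsSmoothForm α)
    (hclass : HasConstantClass α k)
    (hrank : ∀ x, Module.finrank ℝ (kerContact α k x) + (2 * k + 1) = Module.finrank ℝ E) :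
    IsTransverseForm (contactField α) (kerContact α k) := by
  refine isTransverseForm_contactField hα fun x v ↦ ?_
  have h : kerContact α k x = formKer (formAt α x) ⊓ formKer (formAt (extDer α) x) :=
    formKer_contact_eq (hclass x).2 (hrank x)
  rw [h, Submodule.mem_inf, mem_formKer_one, mem_formKer_two]

theorem finrank_kerTwo_add {η : DForm E M 2} {r : ℕ} {x : M} (h : formRank (formAt η x) = r) :
    Module.finrank ℝ (kerTwo η x) + r = Module.finrank ℝ E := by
  rw [← finrank_tangentSpace (E := E) x, ← h, add_comm]
  exact Submodule.finrank_quotient_add_finrank _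

theorem finrank_add_of_isCompl {D₁ D₂ : Distribution E M} {x : M} (h : IsCompl (D₁ x) (D₂ x)) :
    Module.finrank ℝ (D₁ x) + Module.finrank ℝ (D₂ x) = Module.finrank ℝ E :=
  Submodule.finrank_add_eq_of_isCompl h

variable [T2Space M] [SigmaCompactSpace M] {k l : ℕ}

theorem IsSymplecticPair.admitOrthogonalMinimalMetric {η₁ η₂ : DForm E M 2}
    (h : IsSymplecticPair k l η₁ η₂) :
    AdmitOrthogonalMinimalMetric (kerTwo η₁) (kerTwo η₂) := by
  have r₁ (x : M) := finrank_kerTwo_add (h.rank₁ x)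
  have r₂ (x : M) := finrank_kerTwo_add (h.rank₂ x)
  have hn := h.complementary
  refine admitOrthogonalMinimalMetric_of_isTransverseForm (p := 2 * l) (q := 2 * k) (fun x ↦ ?_)
    (isTransverseForm_kerTwo h.smooth₁ h.closed₁) (isTransverseForm_kerTwo h.smooth₂ h.closed₂)
    (fun x ↦ ?_) fun x ↦ ?_
  -- A common kernel vector lies in ker η₂ and annihilates η₁, so it is zero by nondegeneracy of η₁
  -- there; the ranks supply complementary dimensions.
  · rw [Submodule.isCompl_iff_disjoint, Submodule.disjoint_def]
    · intro v hv hv'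
      exact h.symplectic₁ x v hv' fun w _ ↦ (mem_formKer_two (η₁ x) v).1 hv w
    · have := r₁ x
      have := r₂ x
      rw [finrank_tangentSpace]
      omega
  · have := r₁ x
    omega
  · have := r₂ x
    omega

theorem IsContactSymplecticPair.admitOrthogonalMinimalMetric {α : DForm E M 1} {β : DForm E M 2}
    (h : IsContactSymplecticPair k l α β) :
    AdmitOrthogonalMinimalMetric (kerContact α k) (kerTwo β) := by
  -- The codimension of ker(α ∧ (dα)^k) is the dimension 2k + 1 of the complementary leaves on which
  -- α is contact.
  have r₁ (x : M) : Module.finrank ℝ (kerContact α k x) + (2 * k + 1) = Module.finrank ℝ E := by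
    rw [← finrank_add_of_isCompl (h.complementary x), (h.contact₁ x).1]
  refine admitOrthogonalMinimalMetric_of_isTransverseForm (p := 2 * l) h.complementary
    (isTransverseForm_kerContact h.smooth₁ h.class₁ r₁)
    (isTransverseForm_kerTwo h.smooth₂ h.closed₂) (fun x ↦ ?_) fun x ↦ (h.contact₁ x).1
  have h1 := r₁ x
  have h2 := finrank_kerTwo_add (h.rank₂ x)
  have h3 := (h.contact₁ x).1
  omega

theorem IsContactPair.admitOrthogonalMinimalMetric {α γ : DForm E M 1}
    (h : IsContactPair k l α γ) :
    AdmitOrthogonalMinimalMetric (kerContact α k) (kerContact γ l) := by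
  have r₁ (x : M) : Module.finrank ℝ (kerContact α k x) + (2 * k + 1) = Module.finrank ℝ E := by
    rw [← finrank_add_of_isCompl (h.complementary x), (h.contact₁ x).1]
  have r₂ (x : M) : Module.finrank ℝ (kerContact γ l x) + (2 * l + 1) = Module.finrank ℝ E := by
    rw [← finrank_add_of_isCompl (h.complementary x), (h.contact₂ x).1, add_comm]
  exact admitOrthogonalMinimalMetric_of_isTransverseForm h.complementary
    (isTransverseForm_kerContact h.smooth₁ h.class₁ r₁)
    (isTransverseForm_kerContact h.smooth₂ h.class₂ r₂)
    (fun x ↦ (h.contact₂ x).1) fun x ↦ (h.contact₁ x).1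

end Pairs

end CharPair

end

theorem mainTheorem9 {E : Type*} [NormedAddCommGroup E] [NormedSpace ℝ E] [FiniteDimensional ℝ E]
    {M : Type*} [TopologicalSpace M] [ChartedSpace E M] [IsManifold 𝓘(ℝ, E) ∞ M]
    [T2Space M] [SigmaCompactSpace M] (k l : ℕ) :
    (∀ η₁ η₂ : CharPair.DForm E M 2, CharPair.IsSymplecticPair k l η₁ η₂ →
      CharPair.AdmitOrthogonalMinimalMetric (CharPair.kerTwo η₁) (CharPair.kerTwo η₂)) ∧
    (∀ (α : CharPair.DForm E M 1) (β : CharPair.DForm E M 2),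
      CharPair.IsContactSymplecticPair k l α β →
      CharPair.AdmitOrthogonalMinimalMetric (CharPair.kerContact α k) (CharPair.kerTwo β)) ∧
    (∀ α γ : CharPair.DForm E M 1, CharPair.IsContactPair k l α γ →
      CharPair.AdmitOrthogonalMinimalMetric
        (CharPair.kerContact α k) (CharPair.kerContact γ l)) :=
  ⟨fun _ _ h ↦ h.admitOrthogonalMinimalMetric, fun _ _ h ↦ h.admitOrthogonalMinimalMetric,
    fun _ _ h ↦ h.admitOrthogonalMinimalMetric⟩
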